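/- Let $X$ be a nonempty connected graph (loops and multiple edges allowed) with vertex set $V$, and fix an orientation $A$ of $X$, i.e. one oriented edge $e$, with origin $e_-$ and terminus $e_+$, for each geometric edge. Let $(\mathcal G,X)$ be a graph of groups on $X$: discrete groups $G_v$ $(v\in V)$ and $G_e$ $(e\in A)$, and monomorphisms $\sigma_e:G_e\to G_{e_+}$ and $\theta_e:G_e\to G_{e_-}$. Let $T$ be a maximal tree of $X$, and let $G=\pi_1(\mathcal G,X,T)$ be the quotient of the free product of all the $G_v$ and of the free group on $\{t_e: e\in A\}$ by the relations $t_e\sigma_e(g)t_e^{-1}=\theta_e(g)$ $(e\in A,\ g\in G_e)$ and $t_e=1$ $(e\in A$ an edge of $T)$. Let $G$ act on $\ell^2(G)$ by the left regular representation, and let each $G_v$ act on $\ell^2(G)$ through the canonical homomorphism $G_v\to G$. Let $\beta^1(G)\in[0,\infty]$ denote the first $\ell^2$-Betti number of $G$, defined as the von Neumann dimension of the reduced cohomology $\overline H^1(G,\ell^2(G))$, the quotient of the 1-cocycles by the closure of the 1-coboundaries for pointwise convergence, regarded as a module over the group von Neumann algebra $N(G)$ of all bounded $G$-equivariant operators on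 $\ell^2(G)$. Here the von Neumann dimension of an arbitrary $N(G)$-module is the supremum of the von Neumann dimensions of its finitely generated projective submodules. Assume that $X$ has at least one edge and that $H^1(G_v,\ell^2(G))=0$ for every $v\in V$. Then: 1. If $G_e$ is infinite for every edge $e$, then $H^1(G,\ell^2(G))=0$ and $\beta^1(G)=0$. 2. If there is an edge $e\in A$ with $G_e$ finite and $e_+=e_-$, then $H^1(G,\ell^2(G))\neq 0$; if moreover $G$ is non-amenable, then $\beta^1(G)>0$. 3. If there is an edge $e\in A$ with $G_e$ finite, $e_+\neq e_-$, $[G_{e_+}:\sigma_e(G_e)]\geq 2$ and $[G_{e_-}:\theta_e(G_e)]\geq 2$ (the indices may be infinite), then $H^1(G,\ell^2(G))\neq 0$; if moreover $G$ is non-amenable, then $\beta^1(G)>0$. -/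

import Mathlib

open scoped ENNReal

noncomputable section

/-- The Hilbert space `ℓ²(G)` of square-summable complex functions on a set `G`. -/
abbrev EllTwo (G : Type) : Type := lp (fun _ : G => ℂ) 2

theorem memlp_translate {G : Type} [Group G] (g : G) (f : EllTwo G) :
    Memℓp (fun x : G => f (g⁻¹ * x)) 2 := by
  have h := lp.memℓp f
  rw [memℓp_gen_iff (by norm_num)] at h ⊢
  exact ((Equiv.mulLeft g⁻¹).summable_iff (f := fun i => ‖f i‖ ^ (2 : ℝ≥0∞).toReal)).2 h

/-- The left regular representation of `G` on `ℓ²(G)`: `(g • f)(x) = f(g⁻¹ x)`. -/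
def leftReg (G : Type) [Group G] : Representation ℂ G (EllTwo G) where
  toFun g :=
    { toFun := fun f => ⟨fun x => f (g⁻¹ * x), memlp_translate g f⟩
      map_add' := fun _ _ => by ext; rfl
      map_smul' := fun _ _ => by ext; rfl }
  map_one' := by
    ext f x
    change f ((1 : G)⁻¹ * x) = f x
    simp
  map_mul' g h := by
    ext f x
    change f ((g * h)⁻¹ * x) = f (h⁻¹ * (g⁻¹ * x))
    simp [mul_assoc]

/-- `ℓ²(G)` as an object of the category of representations of `G`. -/
abbrev ellTwoRep (G : Type) [Group G] : Rep ℂ G := Rep.of (leftReg G)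

/-- `ℓ²(G)` as a representation of `H`, through a homomorphism `φ : H → G`. -/
abbrev ellTwoRes {H G : Type} [Group H] [Group G] (φ : H →* G) : Rep ℂ H :=
  Rep.of ((leftReg G).comp φ)

/-- The algebra of all bounded operators on `ℓ²(G)` that commute with the left regular
representation. -/
def equivariantOperators (G : Type) [Group G] : Subalgebra ℂ (EllTwo G →L[ℂ] EllTwo G) where
  carrier := {T | ∀ (g : G) (f : EllTwo G), T (leftReg G g f) = leftReg G g (T f)}
  mul_mem' := fun {S T} hS hT g f => by
    change S (T (leftReg G g f)) = leftReg G g (S (T f))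
    rw [hT, hS]
  add_mem' := fun {S T} hS hT g f => by
    change S (leftReg G g f) + T (leftReg G g f) = leftReg G g (S f + T f)
    rw [hS, hT, map_add]
  algebraMap_mem' := fun c g f => by
    change c • leftReg G g f = leftReg G g (c • f)
    rw [map_smul]

/-- The group von Neumann algebra `N(G)`, i.e. `equivariantOperators G` as a type; its ring
structure and its action on `ℓ²(G)` are the evident ones. -/
def GroupVN (G : Type) [Group G] : Type := equivariantOperators G

/-- The bounded operator underlying an element of `N(G)`. -/
def GroupVN.op {G : Type} [Group G] (T : GroupVN G) : EllTwo G →L[ℂ] EllTwo G :=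
  Subtype.val (p := fun S => S ∈ equivariantOperators G) T

instance (G : Type) [Group G] : Ring (GroupVN G) := inferInstanceAs (Ring (equivariantOperators G))

instance (G : Type) [Group G] : Module (GroupVN G) (EllTwo G) where
  smul T f := T.op f
  one_smul _ := rfl
  mul_smul _ _ _ := rfl
  smul_zero T := map_zero T.op
  smul_add T := map_add T.op
  add_smul _ _ _ := rfl
  zero_smul _ := rfl

theorem groupVN_smul_leftReg {G : Type} [Group G] (T : GroupVN G) (g : G) (f : EllTwo G) :
    T • leftReg G g f = leftReg G g (T • f) := T.2 g f

instance (G : Type) [Group G] : ContinuousConstSMul (GroupVN G) (EllTwo G) :=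
  ⟨fun T => T.op.continuous⟩

/-- The von Neumann trace on `N(G)`: `tr T = ⟨T δ₁, δ₁⟩ = (T δ₁)(1)`. -/
def vnTrace {G : Type} [Group G] (T : GroupVN G) : ℂ :=
  open scoped Classical in T.op (lp.single 2 (1 : G) (1 : ℂ)) 1

/-- The von Neumann dimension of an arbitrary left `N(G)`-module `M`: the supremum of the
dimensions of the finitely generated projective modules that embed into `M`.  Every finitely
generated projective left module is isomorphic to the module `N(G)ⁿ e` of row vectors for some
idempotent matrix `e` over `N(G)`, and its dimension is the trace of `e` (which is a nonnegative
real number). -/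
def vnDim (G : Type) [Group G] (M : Type) [AddCommGroup M] [Module (GroupVN G) M] : ℝ≥0∞ :=
  ⨆ (n : ℕ) (e : Matrix (Fin n) (Fin n) (GroupVN G))
    (_ : e * e = e ∧ ∃ f : LinearMap.range e.vecMulLinear →ₗ[GroupVN G] M, Function.Injective f),
    ENNReal.ofReal (∑ i, vnTrace (e i i)).re

/-- The 1-cocycles `Z¹(G, ℓ²(G))`, with the module structure `(T • c)(g) = T (c g)` over `N(G)`. -/
def cocyclesVN (G : Type) [Group G] : Submodule (GroupVN G) (G → EllTwo G) where
  carrier := (groupCohomology.cocycles₁ (ellTwoRep G) : Set (G → EllTwo G))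
  add_mem' := fun ha hb => (groupCohomology.cocycles₁ (ellTwoRep G)).add_mem ha hb
  zero_mem' := zero_mem (groupCohomology.cocycles₁ (ellTwoRep G))
  smul_mem' := fun T c hc => by
    rw [SetLike.mem_coe, groupCohomology.mem_cocycles₁_iff] at hc ⊢
    intro g h
    change T • c (g * h) = leftReg G g (T • c h) + T • c g
    rw [hc g h, smul_add]
    congr 1
    exact groupVN_smul_leftReg T g (c h)

/-- The 1-coboundaries `B¹(G, ℓ²(G))`, as a module over `N(G)`. -/
def coboundariesVN (G : Type) [Group G] : Submodule (GroupVN G) (G → EllTwo G) where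
  carrier := (groupCohomology.coboundaries₁ (ellTwoRep G) : Set (G → EllTwo G))
  add_mem' := fun ha hb => (groupCohomology.coboundaries₁ (ellTwoRep G)).add_mem ha hb
  zero_mem' := zero_mem (groupCohomology.coboundaries₁ (ellTwoRep G))
  smul_mem' := fun T c hc => by
    obtain ⟨ξ, rfl⟩ := hc
    refine ⟨T • (ξ : EllTwo G), ?_⟩
    funext g
    change leftReg G g (T • (ξ : EllTwo G)) - T • (ξ : EllTwo G)
      = T • (leftReg G g (ξ : EllTwo G) - (ξ : EllTwo G))
    rw [smul_sub, groupVN_smul_leftReg]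

/-- The reduced first cohomology of `G` with coefficients in `ℓ²(G)`: 1-cocycles modulo the
closure of the 1-coboundaries, for the topology of pointwise convergence on `G` (that is, of
uniform convergence on the compact subsets of the discrete group `G`). -/
abbrev ReducedH1 (G : Type) [Group G] : Type :=
  cocyclesVN G ⧸ (coboundariesVN G).topologicalClosure.submoduleOf (cocyclesVN G)

/-- The first `ℓ²`-Betti number of a discrete group: the von Neumann dimension of the reduced
first cohomology with coefficients in `ℓ²(G)`. -/
def bettiOne (G : Type) [Group G] : ℝ≥0∞ := vnDim G (ReducedH1 G)

/-- A discrete group is amenable if it carries a left-invariant finitely additive probability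
measure defined on all of its subsets. -/
def AmenableGroup (G : Type) [Group G] : Prop :=
  ∃ m : Set G → ℝ, (∀ s, 0 ≤ m s) ∧ m Set.univ = 1 ∧
    (∀ s t, Disjoint s t → m (s ∪ t) = m s + m t) ∧
    ∀ (g : G) (s : Set G), m ((fun x => g * x) '' s) = m s

/-- A graph of groups over the graph with vertex set `V` and with `A` as the set of edges of a
fixed orientation: every geometric edge is listed once in `A`, with origin `src e` and terminus
`tgt e` (loops and multiple edges are allowed).  It consists of a vertex group for each vertex,
an edge group for each edge, and monomorphisms from each edge group to the vertex groups at the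
terminus and at the origin of the edge. -/
structure GraphOfGroups (V A : Type) where
  src : A → V
  tgt : A → V
  vertexGroup : V → Type
  edgeGroup : A → Type
  [instVertex : ∀ v, Group (vertexGroup v)]
  [instEdge : ∀ e, Group (edgeGroup e)]
  toTgt : ∀ e, edgeGroup e →* vertexGroup (tgt e)
  toSrc : ∀ e, edgeGroup e →* vertexGroup (src e)
  toTgt_injective : ∀ e, Function.Injective (toTgt e)
  toSrc_injective : ∀ e, Function.Injective (toSrc e)

namespace GraphOfGroups

attribute [instance] GraphOfGroups.instVertex GraphOfGroups.instEdge

variable {V A : Type} (X : GraphOfGroups V A)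

/-- `T` is (the edge set of) a maximal tree: together with all the vertices, the edges in `T`
form a tree (no loops, no multiple edges, connected, no cycles).  The existence of such a `T`
means exactly that the underlying graph is nonempty and connected. -/
def IsMaximalTree (T : Set A) : Prop :=
  (∀ e ∈ T, X.src e ≠ X.tgt e) ∧
  Set.InjOn (fun e => s(X.src e, X.tgt e)) T ∧
  (SimpleGraph.fromRel fun v w => ∃ e ∈ T, X.src e = v ∧ X.tgt e = w).IsTree

/-- The free product of all the vertex groups and of the free group on the edges `A`. -/
abbrev FreeProd : Type := Monoid.Coprod (Monoid.CoprodI X.vertexGroup) (FreeGroup A)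

/-- The element of the free product given by an element of a vertex group. -/
def vert (v : V) : X.vertexGroup v →* X.FreeProd := Monoid.Coprod.inl.comp Monoid.CoprodI.of

/-- The stable letter `t_e` in the free product. -/
def letter (e : A) : X.FreeProd := Monoid.Coprod.inr (FreeGroup.of e)

/-- The relators: `t_e g t_e⁻¹ = θ_e(g)` for `g` in the edge group of `e`, where on the left `g` is
read in the vertex group at the terminus of `e` and `θ_e` maps to the vertex group at its origin;
and `t_e = 1` for `e` in `T`. -/
def relators (T : Set A) : Set X.FreeProd :=
  {r | ∃ (e : A) (g : X.edgeGroup e),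
    r = X.letter e * X.vert (X.tgt e) (X.toTgt e g) * (X.letter e)⁻¹
      * (X.vert (X.src e) (X.toSrc e g))⁻¹} ∪
  {r | ∃ e ∈ T, r = X.letter e}

/-- The fundamental group `π₁(X, T)` of the graph of groups with respect to `T`. -/
abbrev PiOne (T : Set A) : Type := X.FreeProd ⧸ Subgroup.normalClosure (X.relators T)

/-- The canonical homomorphism from a vertex group to the fundamental group. -/
def ofVertex (T : Set A) (v : V) : X.vertexGroup v →* X.PiOne T :=
  (QuotientGroup.mk' (Subgroup.normalClosure (X.relators T))).comp (X.vert v)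

end GraphOfGroups

end

open Filter Topology

noncomputable section

/-! ### Potentials on trees -/

/-! Restricted to `G_v`, a cocycle `c` on `G` is the coboundary of some vector `ξ_v`. The relation
`t_e σ_e(g) = θ_e(g) t_e` makes `c(t_e) - (t_e ξ_{e+} - ξ_{e-})` invariant under `θ_e(G_e)`. If
`G_e` is infinite, so is its image, and an invariant square-summable vector is zero. The `ξ_v` then
agree along the tree, hence everywhere, and `c` is a coboundary.

Conversely, invariant vectors on the edges define a cocycle (`exists_cocycle`). For a finite edge
group take the indicator `χ` of its image. If the resulting cocycle were the coboundary of `η`, then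
for some `w` of infinite order `η`, or a vector obtained from it, would have monotone real part
along the powers of `w`, with a nonzero step at `1`; decay at both ends forbids this
(`EllTwo.re_translate_sub_eq_zero`). For an edge outside `T`, `w` is the stable letter; for an edge
in `T`, it is a product of elements of the two end groups outside the edge group, controlled by
normal forms in the amalgam.

That vertex groups and these amalgams embed in `G` is seen on permutations: free actions of a group
on a much larger set are all conjugate, so free actions of the vertex groups assemble into an action
of `G`.

If `G` is non-amenable, the regular representation has a spectral gap, so coboundaries are closed
and a nontrivial cocycle `c` can be made orthogonal to them on a finite set. An operator in `N(G)`
kills its class only if it kills `c`, so `N(G)p` embeds in the reduced cohomology, where `p`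
projects onto the closed span of the translates of the values of `c`; its trace is positive. -/

/-- The ordered product of the labels of the darts of a walk. -/
def SimpleGraph.Walk.labelProd {V H : Type*} [Group H] {Γ : SimpleGraph V} (d : V → V → H) :
    ∀ {v w : V}, Γ.Walk v w → H
  | _, _, .nil => 1
  | _, _, .cons (u := v) (v := w) _ p => d v w * labelProd d p

theorem SimpleGraph.Walk.labelProd_concat {V H : Type*} [Group H] {Γ : SimpleGraph V}
    (d : V → V → H) {u v w : V} (p : Γ.Walk u v) (h : Γ.Adj v w) :
    (p.concat h).labelProd d = p.labelProd d * d v w := by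
  induction p with
  | nil => simp [SimpleGraph.Walk.concat_nil, labelProd]
  | cons h' p ih => simp [SimpleGraph.Walk.concat_cons, labelProd, ih, mul_assoc]

/-- Multiply the labels along the unique path from a root. For adjacent vertices, one of the two
paths extends the other by a single edge. -/
theorem SimpleGraph.IsTree.exists_potential {V H : Type*} [Group H] {Γ : SimpleGraph V}
    (hΓ : Γ.IsTree) (d : V → V → H) (hd : ∀ v w, Γ.Adj v w → d w v = (d v w)⁻¹) :
    ∃ β : V → H, ∀ v w, Γ.Adj v w → β w = β v * d v w := by
  obtain ⟨r⟩ := hΓ.connected.nonempty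
  choose p hp _ using fun v => hΓ.existsUnique_path r v
  refine ⟨fun v => (p v).labelProd d, fun v w h => ?_⟩
  change (p w).labelProd d = (p v).labelProd d * d v w
  by_cases hv : v ∈ (p w).support
  · rw [hΓ.isAcyclic.path_concat (hp v) (hp w) h hv, SimpleGraph.Walk.labelProd_concat]
  · have hw := hΓ.isAcyclic.mem_support_of_ne_mem_support_of_adj_of_isPath (hp v) (hp w) h hv
    rw [hΓ.isAcyclic.path_concat (hp w) (hp v) h.symm hw,
      SimpleGraph.Walk.labelProd_concat, hd v w h]
    group

namespace GraphOfGroups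

variable {V A : Type} (X : GraphOfGroups V A) {T : Set A}

theorem IsMaximalTree.exists_potential {X : GraphOfGroups V A} (hT : X.IsMaximalTree T)
    {H : Type*} [Group H] (h : A → H) :
    ∃ β : V → H, ∀ e ∈ T, β (X.tgt e) = β (X.src e) * h e := by
  classical
  obtain ⟨hloop, hinj, htree⟩ := hT
  -- Absence of loops and multiple edges in `T` makes the chosen edge unique and the first two cases
  -- exclusive.
  let d : V → V → H := fun v w =>
    if hf : ∃ e ∈ T, X.src e = v ∧ X.tgt e = w then h hf.choose
    else if hf : ∃ e ∈ T, X.src e = w ∧ X.tgt e = v then (h hf.choose)⁻¹ else 1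
  have key : ∀ e ∈ T, d (X.src e) (X.tgt e) = h e ∧ d (X.tgt e) (X.src e) = (h e)⁻¹ := by
    intro e he
    have h1 : ∃ f ∈ T, X.src f = X.src e ∧ X.tgt f = X.tgt e := ⟨e, he, rfl, rfl⟩
    have h2 : ¬ ∃ f ∈ T, X.src f = X.tgt e ∧ X.tgt f = X.src e := by
      rintro ⟨f, hf, h3, h4⟩
      have : f = e := hinj hf he (by simp [h3, h4, Sym2.eq_swap])
      subst this
      exact hloop f hf h3
    have h5 : h1.choose = e :=
      hinj h1.choose_spec.1 he (by simp only [h1.choose_spec.2.1, h1.choose_spec.2.2])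
    constructor
    · simp only [d]
      rw [dif_pos h1, h5]
    · simp only [d]
      rw [dif_neg h2, dif_pos h1, h5]
  obtain ⟨β, hβ⟩ := htree.exists_potential d (by
    intro v w hvw
    rw [SimpleGraph.fromRel_adj] at hvw
    obtain ⟨-, ⟨e, he, rfl, rfl⟩ | ⟨e, he, rfl, rfl⟩⟩ := hvw
    · rw [(key e he).1, (key e he).2]
    · rw [(key e he).1, (key e he).2, inv_inv])
  refine ⟨β, fun e he => ?_⟩
  rw [← (key e he).1]
  apply hβ
  rw [SimpleGraph.fromRel_adj]
  exact ⟨hloop e he, Or.inl ⟨e, he, rfl, rfl⟩⟩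

/-- A function on the vertices that takes equal values at the ends of every edge of a maximal
tree is constant. -/
theorem IsMaximalTree.eq_of_forall_eq {X : GraphOfGroups V A} (hT : X.IsMaximalTree T)
    {B : Type*} (f : V → B) (hf : ∀ e ∈ T, f (X.src e) = f (X.tgt e)) (v w : V) : f v = f w := by
  obtain ⟨p⟩ := hT.2.2.connected.preconnected v w
  induction p with
  | nil => rfl
  | cons h _ ih =>
    rw [← ih]
    rw [SimpleGraph.fromRel_adj] at h
    obtain ⟨-, ⟨e, he, rfl, rfl⟩ | ⟨e, he, rfl, rfl⟩⟩ := h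
    · exact hf e he
    · exact (hf e he).symm

/-! ### Homomorphisms from the fundamental group -/

/-- The image of the stable letter `t_e` in the fundamental group. -/
def stable (T : Set A) (e : A) : X.PiOne T :=
  QuotientGroup.mk' (Subgroup.normalClosure (X.relators T)) (X.letter e)

theorem stable_eq_one {e : A} (he : e ∈ T) : X.stable T e = 1 :=
  (QuotientGroup.eq_one_iff _).2 (Subgroup.subset_normalClosure (Or.inr ⟨e, he, rfl⟩))

theorem stable_mul_ofVertex (T : Set A) (e : A) (g : X.edgeGroup e) :
    X.stable T e * X.ofVertex T _ (X.toTgt e g) = X.ofVertex T _ (X.toSrc e g) * X.stable T e := by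
  have h : QuotientGroup.mk' (Subgroup.normalClosure (X.relators T))
      (X.letter e * X.vert (X.tgt e) (X.toTgt e g) * (X.letter e)⁻¹
      * (X.vert (X.src e) (X.toSrc e g))⁻¹) = 1 :=
    (QuotientGroup.eq_one_iff _).2 (Subgroup.subset_normalClosure (Or.inl ⟨e, g, rfl⟩))
  rw [map_mul, map_mul, map_mul, map_inv, map_inv, mul_inv_eq_one, mul_inv_eq_iff_eq_mul] at h
  exact h

theorem exists_hom {H : Type*} [Group H] (ρ : ∀ v, X.vertexGroup v →* H) (τ : A → H)
    (hrel : ∀ e g, τ e * ρ _ (X.toTgt e g) = ρ _ (X.toSrc e g) * τ e)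
    (hT : ∀ e ∈ T, τ e = 1) :
    ∃ Φ : X.PiOne T →* H,
      (∀ v g, Φ (X.ofVertex T v g) = ρ v g) ∧ ∀ e, Φ (X.stable T e) = τ e := by
  let F : X.FreeProd →* H := Monoid.Coprod.lift (Monoid.CoprodI.lift ρ) (FreeGroup.lift τ)
  have hv : ∀ v g, F (X.vert v g) = ρ v g := fun v g => by simp [F, vert]
  have ht : ∀ e, F (X.letter e) = τ e := fun e => by simp [F, letter]
  have hF : Subgroup.normalClosure (X.relators T) ≤ F.ker := by
    refine Subgroup.normalClosure_le_normal ?_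
    rintro r (⟨e, g, rfl⟩ | ⟨e, he, rfl⟩)
    · simp [MonoidHom.mem_ker, hv, ht, hrel]
    · simp [MonoidHom.mem_ker, ht, hT e he]
  exact ⟨QuotientGroup.lift _ F hF, hv, ht⟩

/-- If the relations of the edges hold, then the relations `t_e = 1` for `e` in a maximal tree can
be achieved by conjugating the vertex groups. -/
theorem IsMaximalTree.exists_hom_conj {X : GraphOfGroups V A} (hT : X.IsMaximalTree T)
    {H : Type*} [Group H] (ρ : ∀ v, X.vertexGroup v →* H) (τ : A → H)
    (hrel : ∀ e g, τ e * ρ _ (X.toTgt e g) = ρ _ (X.toSrc e g) * τ e) :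
    ∃ (Φ : X.PiOne T →* H) (β : V → H), (∀ v g, Φ (X.ofVertex T v g) = β v * ρ v g * (β v)⁻¹) ∧
      ∀ e ∈ T, β (X.tgt e) = β (X.src e) * τ e := by
  obtain ⟨β, hβ⟩ := hT.exists_potential τ
  obtain ⟨Φ, hΦ, -⟩ := X.exists_hom (T := T) (fun v => (MulAut.conj (β v)).toMonoidHom.comp (ρ v))
    (fun e => β (X.src e) * τ e * (β (X.tgt e))⁻¹)
    (fun e g => by
      have := hrel e g
      simp only [MonoidHom.comp_apply, MulEquiv.coe_toMonoidHom, MulAut.conj_apply]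
      simp only [mul_assoc, inv_mul_cancel_left]
      rw [← mul_assoc (τ e), this]
      simp only [mul_assoc])
    (fun e he => by rw [hβ e he, mul_inv_cancel])
  exact ⟨Φ, β, fun v g => by simp [hΦ], hβ⟩

theorem closure_generators (K : Subgroup (X.PiOne T)) (hv : ∀ v g, X.ofVertex T v g ∈ K)
    (ht : ∀ e, X.stable T e ∈ K) : K = ⊤ := by
  rw [eq_top_iff]
  rintro x -
  induction x using QuotientGroup.induction_on with
  | H y =>
    change y ∈ K.comap (QuotientGroup.mk' (Subgroup.normalClosure (X.relators T)))
    induction y using Monoid.Coprod.induction_on with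
    | inl m =>
      induction m using Monoid.CoprodI.induction_on with
      | one => rw [map_one]; exact one_mem _
      | of v g => exact hv v g
      | mul a b ha hb => rw [map_mul]; exact mul_mem ha hb
    | inr n =>
      induction n using FreeGroup.induction_on with
      | C1 => rw [map_one]; exact one_mem _
      | of e => exact ht e
      | inv_of e he => rw [map_inv]; exact inv_mem he
      | mul a b ha hb => rw [map_mul]; exact mul_mem ha hb
    | mul a b ha hb => exact mul_mem ha hb

/-- A stable letter outside of the maximal tree has infinite order. -/
theorem exists_hom_int {e : A} (he : e ∉ T) :
    ∃ Φ : X.PiOne T →* Multiplicative ℤ, Φ (X.stable T e) = Multiplicative.ofAdd 1 := by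
  classical
  obtain ⟨Φ, -, h⟩ := X.exists_hom (T := T) (fun _ => 1)
    (fun f => if f = e then Multiplicative.ofAdd (1 : ℤ) else 1) (by simp)
    (fun f hf => if_neg (by rintro rfl; exact he hf))
  exact ⟨Φ, by simp [h]⟩

/-! ### Free permutation representations -/

end GraphOfGroups

/-- A permutation representation is free if non-trivial elements have no fixed points. -/
def IsFreePerm {C Ω : Type*} [Group C] (ρ : C →* Equiv.Perm Ω) : Prop :=
  ∀ c x, ρ c x = x → c = 1

theorem IsFreePerm.injective {C Ω : Type*} [Group C] [Nonempty Ω] {ρ : C →* Equiv.Perm Ω}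
    (h : IsFreePerm ρ) : Function.Injective ρ := by
  rw [injective_iff_map_eq_one]
  intro c hc
  exact h c (Classical.arbitrary Ω) (by rw [hc]; rfl)

theorem IsFreePerm.comp {B C Ω : Type*} [Group B] [Group C] {ρ : C →* Equiv.Perm Ω}
    (h : IsFreePerm ρ) {f : B →* C} (hf : Function.Injective f) : IsFreePerm (ρ.comp f) :=
  fun b x hb => (injective_iff_map_eq_one f).1 hf b (h (f b) x hb)

-- A free action splits into regular orbits. As `C` is smaller than the infinite set `Ω`, there must
-- be `#Ω` orbits, so the action is isomorphic to `C × Ω`.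
open Cardinal in
theorem IsFreePerm.exists_equiv {C Ω : Type} [Group C] [Infinite Ω] (hC : #C < #Ω)
    {ρ : C →* Equiv.Perm Ω} (h : IsFreePerm ρ) :
    ∃ φ : C × Ω ≃ Ω, ∀ c d x, φ (c * d, x) = ρ c (φ (d, x)) := by
  let s : Setoid Ω :=
    { r := fun x y => ∃ c, ρ c x = y
      iseqv :=
        { refl := fun x => ⟨1, by simp⟩
          symm := by rintro x _ ⟨c, rfl⟩; exact ⟨c⁻¹, by simp⟩
          trans := by rintro x _ _ ⟨c, rfl⟩ ⟨d, rfl⟩; exact ⟨d * c, by simp⟩ } }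
  have hb : Function.Bijective (fun p : C × Quotient s => ρ p.1 p.2.out) := by
    constructor
    · rintro ⟨c, q⟩ ⟨d, r⟩ hcd
      have hcd : ρ c q.out = ρ d r.out := hcd
      have hqr : q = r := by
        rw [← q.out_eq, ← r.out_eq]
        exact Quotient.sound ⟨d⁻¹ * c, by simp [hcd]⟩
      subst hqr
      have : d⁻¹ * c = 1 := h _ q.out (by simp [hcd])
      rw [inv_mul_eq_one] at this
      simp [this]
    · intro x
      obtain ⟨c, hc⟩ := Quotient.exact (Quotient.out_eq (Quotient.mk s x))
      exact ⟨(c, Quotient.mk s x), hc⟩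
  let ψ := Equiv.ofBijective _ hb
  have hcard : #(Quotient s) = #Ω := by
    have h1 : #C * #(Quotient s) = #Ω := by rw [Cardinal.mul_def]; exact Cardinal.mk_congr ψ
    refine le_antisymm Cardinal.mk_quotient_le ?_
    by_contra! hlt
    exact (Cardinal.mul_lt_of_lt (Cardinal.aleph0_le_mk Ω) hC hlt).ne h1
  obtain ⟨θ⟩ := Cardinal.eq.1 hcard
  exact ⟨((Equiv.refl C).prodCongr θ.symm).trans ψ, fun c d x => by simp [ψ]⟩

-- Both actions are isomorphic to the same model `C × Ω`. The conjugating permutation will serve as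
-- image of a stable letter.
open Cardinal in
theorem IsFreePerm.exists_conj {C Ω : Type} [Group C] [Infinite Ω] (hC : #C < #Ω)
    {ρ ρ' : C →* Equiv.Perm Ω} (h : IsFreePerm ρ) (h' : IsFreePerm ρ') :
    ∃ τ : Equiv.Perm Ω, ∀ c, τ * ρ c = ρ' c * τ := by
  obtain ⟨φ, hφ⟩ := h.exists_equiv hC
  obtain ⟨φ', hφ'⟩ := h'.exists_equiv hC
  refine ⟨φ.symm.trans φ', fun c => ?_⟩
  ext x
  obtain ⟨⟨d, y⟩, rfl⟩ := φ.surjective x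
  simp [Equiv.Perm.mul_apply, ← hφ, ← hφ']

open Cardinal in
theorem exists_isFreePerm (C Ω : Type) [Group C] [Infinite Ω] (hC : #C < #Ω) :
    ∃ ρ : C →* Equiv.Perm Ω, IsFreePerm ρ := by
  have : #(C × Ω) = #Ω := by
    rw [Cardinal.mk_prod, Cardinal.lift_id, Cardinal.lift_id]
    exact Cardinal.mul_eq_right (Cardinal.aleph0_le_mk Ω) hC.le (Cardinal.mk_ne_zero C)
  obtain ⟨ψ⟩ := Cardinal.eq.1 this
  let ρ₀ : C →* Equiv.Perm (C × Ω) :=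
    MonoidHom.mk' (fun c => (Equiv.mulLeft c).prodCongr (Equiv.refl Ω))
      (fun a b => by ext ⟨x, y⟩ <;> simp [mul_assoc])
  refine ⟨ψ.permCongrHom.toMonoidHom.comp ρ₀, fun c x hx => ?_⟩
  obtain ⟨⟨d, y⟩, rfl⟩ := ψ.surjective x
  simpa [ρ₀] using hx

namespace GraphOfGroups

variable {V A : Type} {X : GraphOfGroups V A} {T : Set A}

open Cardinal in
/-- Free permutation representations of the vertex groups on one large set, which agree on the
edge groups for a set `S` of edges, extend to the fundamental group up to conjugation; the
conjugating permutations agree at the ends of the edges of `S` in the maximal tree. -/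
theorem IsMaximalTree.exists_perm (hT : X.IsMaximalTree T) {Ω : Type} [Infinite Ω]
    (hΩ : ∀ v, #(X.vertexGroup v) < #Ω) (ρ : ∀ v, X.vertexGroup v →* Equiv.Perm Ω)
    (hρ : ∀ v, IsFreePerm (ρ v)) (S : Set A)
    (hS : ∀ e ∈ S, ∀ g, ρ _ (X.toTgt e g) = ρ _ (X.toSrc e g)) :
    ∃ (Φ : X.PiOne T →* Equiv.Perm Ω) (β : V → Equiv.Perm Ω),
      (∀ v g, Φ (X.ofVertex T v g) = β v * ρ v g * (β v)⁻¹) ∧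
      ∀ e ∈ T, e ∈ S → β (X.tgt e) = β (X.src e) := by
  have : ∀ e, ∃ τ : Equiv.Perm Ω, (∀ g, τ * ρ _ (X.toTgt e g) = ρ _ (X.toSrc e g) * τ) ∧
      (e ∈ S → τ = 1) := by
    intro e
    by_cases he : e ∈ S
    · exact ⟨1, fun g => by rw [one_mul, mul_one, hS e he], fun _ => rfl⟩
    · obtain ⟨τ, hτ⟩ := IsFreePerm.exists_conj
        ((Cardinal.mk_le_of_injective (X.toTgt_injective e)).trans_lt (hΩ _))
        ((hρ _).comp (X.toTgt_injective e)) ((hρ _).comp (X.toSrc_injective e))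
      exact ⟨τ, hτ, fun h => absurd h he⟩
  choose τ hτ hτS using this
  obtain ⟨Φ, β, hΦ, hβ⟩ := hT.exists_hom_conj ρ τ hτ
  exact ⟨Φ, β, hΦ, fun e he heS => by rw [hβ e he, hτS e heS, mul_one]⟩

-- Cantor's theorem provides a single set strictly larger than every vertex group at once.
open Cardinal in
theorem mk_vertexGroup_lt (X : GraphOfGroups V A) (v : V) :
    #(X.vertexGroup v) < #(Set (Σ v, X.vertexGroup v)) := by
  rw [Cardinal.mk_set]
  exact (Cardinal.mk_le_of_injective sigma_mk_injective).trans_lt (Cardinal.cantor _)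

/-- The vertex groups embed into the fundamental group. -/
theorem IsMaximalTree.ofVertex_injective (hT : X.IsMaximalTree T) (v : V) :
    Function.Injective (X.ofVertex T v) := by
  -- The factor `ℕ` makes the set infinite even when all vertex groups are finite.
  let Ω := ℕ × Set (Σ v, X.vertexGroup v)
  have hΩ : ∀ v, Cardinal.mk (X.vertexGroup v) < Cardinal.mk Ω := fun v =>
    (X.mk_vertexGroup_lt v).trans_le
      (Cardinal.mk_le_of_injective (f := fun s => ((0, s) : Ω)) (fun _ _ h => (Prod.mk.inj h).2))
  choose ρ hρ using fun v => exists_isFreePerm (X.vertexGroup v) Ω (hΩ v)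
  obtain ⟨Φ, β, hΦ, -⟩ := hT.exists_perm hΩ ρ hρ ∅ (by simp)
  rw [injective_iff_map_eq_one]
  intro g hg
  have h1 := hΦ v g
  rw [hg, map_one, eq_comm, mul_inv_eq_one, mul_eq_left] at h1
  exact (injective_iff_map_eq_one _).1 (hρ v).injective g h1

end GraphOfGroups

/-! ### Alternating words in amalgamated products -/

namespace Monoid.PushoutI

variable {ι H : Type*} {G : ι → Type*} [∀ i, Group (G i)] [Group H] {φ : ∀ i, H →* G i}

/-- Prepending a letter outside of the base group to a reduced word. -/
theorem Reduced.exists_cons {w : CoprodI.Word G} (hw : Reduced φ w) {i : ι} {x : G i}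
    (hx : x ∉ (φ i).range) (hi : w.fstIdx ≠ some i) :
    ∃ w' : CoprodI.Word G, Reduced φ w' ∧ w'.fstIdx = some i ∧
      ofCoprodI (φ := φ) w'.prod = of i x * ofCoprodI w.prod := by
  have hx1 : x ≠ 1 := by rintro rfl; exact hx (one_mem _)
  refine ⟨CoprodI.Word.cons x w hi hx1, ?_, by simp, by simp⟩
  intro g hg
  rw [CoprodI.Word.cons, List.mem_cons] at hg
  rcases hg with rfl | hg
  · exact hx
  · exact hw g hg

/-- The induction records that the word does not begin in the factor `j`, so that `y` and then `x`
can be prepended. -/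
theorem exists_reduced_pow {i j : ι} (hij : i ≠ j) {x : G i} {y : G j}
    (hx : x ∉ (φ i).range) (hy : y ∉ (φ j).range) (n : ℕ) :
    ∃ w : CoprodI.Word G, Reduced φ w ∧ w.fstIdx ≠ some j ∧ (n ≠ 0 → w.fstIdx = some i) ∧
      ofCoprodI (φ := φ) w.prod = (of i x * of j y) ^ n := by
  induction n with
  | zero => exact ⟨.empty, by simp [Reduced, CoprodI.Word.empty],
      by simp [CoprodI.Word.empty, CoprodI.Word.fstIdx], by simp, by simp⟩
  | succ n ih =>
    obtain ⟨w, hw, hj, -, hprod⟩ := ih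
    obtain ⟨w', hw', hj', hprod'⟩ := hw.exists_cons hy hj
    obtain ⟨w'', hw'', hi'', hprod''⟩ := hw'.exists_cons hx (by rw [hj']; simpa using hij.symm)
    exact ⟨w'', hw'', by rw [hi'']; simpa using hij, fun _ => hi'', by
      rw [hprod'', hprod', hprod, pow_succ', mul_assoc]⟩

theorem Reduced.notMem_range (hφ : ∀ i, Function.Injective (φ i)) {w : CoprodI.Word G}
    (hw : Reduced φ w) {i : ι} (hi : w.fstIdx = some i) :
    ofCoprodI w.prod ∉ (base φ).range := by
  intro h
  rw [hw.eq_empty_of_mem_range hφ h] at hi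
  simp [CoprodI.Word.empty, CoprodI.Word.fstIdx] at hi

theorem pow_ne_one (hφ : ∀ i, Function.Injective (φ i)) {i j : ι} (hij : i ≠ j) {x : G i}
    {y : G j} (hx : x ∉ (φ i).range) (hy : y ∉ (φ j).range) {n : ℕ} (hn : n ≠ 0) :
    (of (φ := φ) i x * of j y) ^ n ≠ 1 := by
  obtain ⟨w, hw, -, hi, hprod⟩ := exists_reduced_pow hij hx hy n
  rw [← hprod]
  intro h
  exact hw.notMem_range hφ (hi hn) (h ▸ one_mem _)

/-- Otherwise `x⁻¹(xy)^k` lies in the base group. But it equals `y(xy)^(k-1)` for `k > 0` and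
`x⁻¹(y⁻¹x⁻¹)^(-k)` for `k ≤ 0`, both nonempty reduced words. -/
theorem zpow_ne (hφ : ∀ i, Function.Injective (φ i)) {i j : ι} (hij : i ≠ j) {x : G i}
    {y : G j} (hx : x ∉ (φ i).range) (hy : y ∉ (φ j).range) (k : ℤ) (h : H) :
    (of (φ := φ) i x * of j y) ^ k ≠ of i x * base φ h := by
  have hx' : x⁻¹ ∉ (φ i).range := by rwa [inv_mem_iff]
  have hy' : y⁻¹ ∉ (φ j).range := by rwa [inv_mem_iff]
  intro heq
  rw [← inv_mul_eq_iff_eq_mul] at heq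
  rcases lt_or_ge 0 k with hk | hk
  · obtain ⟨n, rfl⟩ : ∃ n : ℕ, k = (n + 1 : ℕ) := ⟨(k - 1).toNat, by omega⟩
    obtain ⟨w, hw, hj, -, hprod⟩ := exists_reduced_pow hij hx hy n
    obtain ⟨w', hw', hi', hprod'⟩ := hw.exists_cons hy hj
    refine hw'.notMem_range hφ hi' ⟨h, ?_⟩
    rw [hprod', hprod, ← heq, zpow_natCast, pow_succ', mul_assoc, inv_mul_cancel_left]
  · obtain ⟨n, rfl⟩ : ∃ n : ℕ, k = -n := ⟨(-k).toNat, by omega⟩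
    obtain ⟨w, hw, hi, -, hprod⟩ := exists_reduced_pow hij.symm hy' hx' n
    obtain ⟨w', hw', hi', hprod'⟩ := hw.exists_cons hx' hi
    refine hw'.notMem_range hφ hi' ⟨h, ?_⟩
    rw [hprod', hprod, ← heq, zpow_neg, zpow_natCast, ← inv_pow, mul_inv_rev, map_inv, map_inv]

end Monoid.PushoutI

/-! ### The amalgam over an edge of the maximal tree -/

namespace GraphOfGroups

variable {V A : Type} {X : GraphOfGroups V A} {T : Set A}

/-- The two inclusions of an edge group into the vertex groups at its ends. -/
def ends (X : GraphOfGroups V A) (e : A) :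
    ∀ i : Bool, X.edgeGroup e →* X.vertexGroup (bif i then X.tgt e else X.src e)
  | true => X.toTgt e
  | false => X.toSrc e

theorem ends_injective (X : GraphOfGroups V A) (e : A) :
    ∀ i : Bool, Function.Injective (X.ends e i)
  | true => X.toTgt_injective e
  | false => X.toSrc_injective e

/-- For an edge of the maximal tree, the vertex groups at its ends generate their amalgamated
product over the edge group. -/
theorem IsMaximalTree.exists_pushout_hom (hT : X.IsMaximalTree T) {e : A} (he : e ∈ T) :
    ∃ (Ω : Type) (L : Monoid.PushoutI (X.ends e) →* Equiv.Perm Ω)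
      (Φ : X.PiOne T →* Equiv.Perm Ω), Function.Injective L ∧
      (∀ g : X.vertexGroup (X.tgt e),
        Φ (X.ofVertex T _ g) = L (Monoid.PushoutI.of (φ := X.ends e) true g)) ∧
      ∀ g : X.vertexGroup (X.src e),
        Φ (X.ofVertex T _ g) = L (Monoid.PushoutI.of (φ := X.ends e) false g) := by
  classical
  let P := Monoid.PushoutI (X.ends e)
  let S := ℕ × Set (Σ v, X.vertexGroup v)
  let Ω := P × S
  have hΩ : ∀ v, Cardinal.mk (X.vertexGroup v) < Cardinal.mk Ω := fun v =>
    (X.mk_vertexGroup_lt v).trans_le (Cardinal.mk_le_of_injective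
      (f := fun s => ((1, 0, s) : Ω)) (fun _ _ h => (Prod.mk.inj (Prod.mk.inj h).2).2))
  let L : P →* Equiv.Perm Ω :=
    MonoidHom.mk' (fun c => (Equiv.mulLeft c).prodCongr (Equiv.refl S))
      (fun a b => by ext x <;> simp [mul_assoc])
  have hL : IsFreePerm L := by
    rintro c ⟨d, y⟩ hx
    exact mul_eq_right.1 (congrArg Prod.fst hx)
  have hof : ∀ i, Function.Injective (Monoid.PushoutI.of (φ := X.ends e) i) :=
    Monoid.PushoutI.of_injective (X.ends_injective e)
  choose ρ₀ hρ₀ using fun v => exists_isFreePerm (X.vertexGroup v) Ω (hΩ v)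
  let ρt : X.vertexGroup (X.tgt e) →* Equiv.Perm Ω :=
    L.comp (Monoid.PushoutI.of (φ := X.ends e) true)
  let ρs : X.vertexGroup (X.src e) →* Equiv.Perm Ω :=
    L.comp (Monoid.PushoutI.of (φ := X.ends e) false)
  -- The two end groups act through the free action of the amalgam, hence compatibly on the edge
  -- group; all other vertex groups act by arbitrary free actions.
  let ρ : ∀ v, X.vertexGroup v →* Equiv.Perm Ω :=
    Function.update (Function.update ρ₀ (X.src e) ρs) (X.tgt e) ρt
  have hρt : ρ (X.tgt e) = ρt := Function.update_self _ _ _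
  have hρs : ρ (X.src e) = ρs := by
    simp only [ρ]
    rw [Function.update_of_ne (hT.1 e he), Function.update_self]
  have hρ : ∀ v, IsFreePerm (ρ v) := by
    intro v
    by_cases h1 : v = X.tgt e
    · subst h1
      rw [hρt]
      exact hL.comp (hof true)
    by_cases h2 : v = X.src e
    · subst h2
      rw [hρs]
      exact hL.comp (hof false)
    · simp only [ρ]
      rw [Function.update_of_ne h1, Function.update_of_ne h2]
      exact hρ₀ v
  obtain ⟨Φ, β, hΦ, hβ⟩ := hT.exists_perm hΩ ρ hρ {e} (by
    intro f hf g
    obtain rfl : f = e := hf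
    rw [hρt, hρs]
    exact congrArg L ((Monoid.PushoutI.of_apply_eq_base (X.ends f) true g).trans
      (Monoid.PushoutI.of_apply_eq_base (X.ends f) false g).symm))
  -- The conjugators agree at both ends of `e`, so one conjugation removes them both.
  refine ⟨Ω, L, (MulAut.conj (β (X.src e))⁻¹).toMonoidHom.comp Φ, hL.injective, fun g => ?_,
    fun g => ?_⟩
  · rw [MonoidHom.comp_apply, hΦ, hβ e he rfl, hρt]
    simp [mul_assoc, ρt]
  · rw [MonoidHom.comp_apply, hΦ, hρs]
    simp [mul_assoc, ρs]

theorem IsMaximalTree.pow_ne_one (hT : X.IsMaximalTree T) {e : A} (he : e ∈ T)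
    {a : X.vertexGroup (X.src e)} {b : X.vertexGroup (X.tgt e)}
    (ha : a ∉ (X.toSrc e).range) (hb : b ∉ (X.toTgt e).range) {n : ℕ} (hn : n ≠ 0) :
    (X.ofVertex T _ b * X.ofVertex T _ a) ^ n ≠ 1 := by
  obtain ⟨Ω, L, Φ, hL, ht, hs⟩ := hT.exists_pushout_hom he
  intro h
  have h1 := congrArg Φ h
  rw [map_pow, map_mul, ht, hs, ← map_mul, ← map_pow, map_one, ← map_one L] at h1
  exact Monoid.PushoutI.pow_ne_one (φ := X.ends e) (X.ends_injective e) (i := true) (j := false)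
    (by simp) hb ha hn (hL h1)

theorem IsMaximalTree.zpow_ne (hT : X.IsMaximalTree T) {e : A} (he : e ∈ T)
    {a : X.vertexGroup (X.src e)} {b : X.vertexGroup (X.tgt e)}
    (ha : a ∉ (X.toSrc e).range) (hb : b ∉ (X.toTgt e).range) (k : ℤ) (g : X.edgeGroup e) :
    (X.ofVertex T _ b * X.ofVertex T _ a) ^ k
      ≠ X.ofVertex T _ b * X.ofVertex T _ (X.toTgt e g) := by
  obtain ⟨Ω, L, Φ, hL, ht, hs⟩ := hT.exists_pushout_hom he
  intro h
  have h1 := congrArg Φ h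
  rw [map_zpow, map_mul, map_mul, ht, ht, hs, ← map_mul, ← map_mul, ← map_zpow] at h1
  exact Monoid.PushoutI.zpow_ne (φ := X.ends e) (X.ends_injective e) (i := true) (j := false)
    (by simp) hb ha k g
    ((hL h1).trans (congrArg _ (Monoid.PushoutI.of_apply_eq_base (X.ends e) true g)))

end GraphOfGroups

/-! ### First cohomology through cocycles -/

theorem groupCohomology.subsingleton_H1_iff {k G : Type} [CommRing k] [Group G] (M : Rep k G) :
    Subsingleton (groupCohomology.H1 M) ↔
      ∀ c : G → M, (∀ g h, c (g * h) = M.ρ g (c h) + c g) → ∃ x, ∀ g, c g = M.ρ g x - x := by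
  constructor
  · intro _ c hc
    have h := (groupCohomology.H1π_eq_zero_iff ⟨c, (mem_cocycles₁_iff c).2 hc⟩).1
      (Subsingleton.elim _ _)
    obtain ⟨x, hx⟩ := h
    exact ⟨x, fun g => (congrFun hx g).symm⟩
  · intro h
    refine ⟨fun x y => ?_⟩
    induction x using groupCohomology.H1_induction_on with
    | h c =>
      induction y using groupCohomology.H1_induction_on with
      | h d =>
        rw [groupCohomology.H1π_eq_iff]
        obtain ⟨x, hx⟩ := h c ((mem_cocycles₁_iff _).1 c.2)
        obtain ⟨y, hy⟩ := h d ((mem_cocycles₁_iff _).1 d.2)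
        refine sub_mem ⟨x, ?_⟩ ⟨y, ?_⟩
        · funext g; exact (hx g).symm
        · funext g; exact (hy g).symm

namespace GraphOfGroups

variable {V A : Type} {X : GraphOfGroups V A} {T : Set A}

/-- A cocycle on the fundamental group with prescribed values on the generators. -/
theorem exists_cocycle {k M : Type*} [CommRing k] [AddCommGroup M] [Module k M]
    (π : Representation k (X.PiOne T) M) (ζ : V → M) (κ : A → M)
    (hκ : ∀ e g, π (X.ofVertex T _ (X.toSrc e g)) (κ e) = κ e)
    (hT : ∀ e ∈ T, ζ (X.tgt e) - ζ (X.src e) + κ e = 0) :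
    ∃ c : X.PiOne T → M, (∀ g h, c (g * h) = π g (c h) + c g) ∧
      (∀ v g, c (X.ofVertex T v g) = π (X.ofVertex T v g) (ζ v) - ζ v) ∧
      ∀ e, c (X.stable T e) = π (X.stable T e) (ζ (X.tgt e)) - ζ (X.src e) + κ e := by
  let L : X.PiOne T →* Equiv.Perm M :=
    MonoidHom.mk' (fun g => ⟨π g, π g⁻¹, fun x => by simp, fun x => by simp⟩)
      (fun a b => by ext x; simp)
  have hL : ∀ g x, L g x = π g x := fun _ _ => rfl
  -- A cocycle is the translation part of an affine action with linear part `π`. The generators are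
  -- sent to the affine maps with the prescribed translations, and `hκ` and `hT` give the two kinds
  -- of relations; `K` below shows that the action is affine with this linear part.
  obtain ⟨Φ, hv, ht⟩ := X.exists_hom (T := T)
    (fun v => (MulAut.conj (Equiv.addRight (-ζ v))).toMonoidHom.comp (L.comp (X.ofVertex T v)))
    (fun e => Equiv.addRight (-ζ (X.src e)) * Equiv.addRight (κ e) * L (X.stable T e) *
      Equiv.addRight (ζ (X.tgt e)))
    (fun e g => by
      ext x
      have h := fun x => LinearMap.congr_fun (congrArg π (X.stable_mul_ofVertex T e g)) x
      simp only [map_mul, Module.End.mul_apply] at h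
      simp [hL, h, hκ]
      abel)
    (fun e he => by
      ext x
      have := hT e he
      simp only [X.stable_eq_one he, map_one, Equiv.Perm.coe_mul, Function.comp_apply,
        Equiv.coe_addRight, Equiv.Perm.coe_one, id_eq]
      rw [← sub_eq_zero, ← this]
      abel)
  let K : Subgroup (X.PiOne T) :=
    { carrier := {g | ∀ x, Φ g x = π g x + Φ g 0}
      one_mem' := fun x => by simp
      mul_mem' := fun {a b} ha hb x => by
        rw [map_mul, Equiv.Perm.mul_apply, Equiv.Perm.mul_apply, hb x, ha, ha (Φ b 0), map_mul,
          Module.End.mul_apply, map_add, add_assoc]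
      inv_mem' := fun {a} ha x => by
        have h0 : π a (Φ a⁻¹ 0) + Φ a 0 = 0 := by rw [← ha]; simp
        apply (Φ a).injective
        rw [ha (π a⁻¹ x + Φ a⁻¹ 0), map_add, add_assoc, h0]
        simp }
  have hK : K = ⊤ := by
    refine X.closure_generators K (fun v g x => ?_) (fun e x => ?_)
    · simp only [hv]
      simp [hL, add_assoc]
    · simp only [ht]
      simp [hL, add_assoc]
  have hall : ∀ g x, Φ g x = π g x + Φ g 0 := fun g => (hK ▸ Subgroup.mem_top g : g ∈ K)
  refine ⟨fun g => Φ g 0, fun g h => ?_, fun v g => ?_, fun e => ?_⟩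
  · change Φ (g * h) 0 = _
    rw [map_mul, Equiv.Perm.mul_apply, hall]
  · simp [hv, hL, sub_eq_add_neg]
  · simp [ht, hL]
    abel

theorem cocycle_eq_of_generators {k M : Type*} [CommRing k] [AddCommGroup M] [Module k M]
    (π : Representation k (X.PiOne T) M) {c : X.PiOne T → M}
    (hc : ∀ g h, c (g * h) = π g (c h) + c g) {x : M}
    (hv : ∀ v g, c (X.ofVertex T v g) = π (X.ofVertex T v g) x - x)
    (ht : ∀ e, c (X.stable T e) = π (X.stable T e) x - x) (g : X.PiOne T) :
    c g = π g x - x := by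
  have h1 : c 1 = 0 := by simpa using hc 1 1
  let K : Subgroup (X.PiOne T) :=
    { carrier := {g | c g = π g x - x}
      one_mem' := by simp [h1]
      mul_mem' := fun {a b} ha hb => by
        simp only [Set.mem_ofPred_eq] at ha hb ⊢
        rw [hc, ha, hb]
        simp
      inv_mem' := fun {a} ha => by
        simp only [Set.mem_ofPred_eq] at ha ⊢
        have h2 := hc a⁻¹ a
        rw [inv_mul_cancel, h1, ha] at h2
        rw [eq_comm, add_comm, ← eq_neg_iff_add_eq_zero] at h2
        rw [h2]
        simp }
  have hK : K = ⊤ := X.closure_generators K hv ht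
  exact (hK ▸ Subgroup.mem_top g : g ∈ K)

end GraphOfGroups

/-! ### Square-summable functions on a group -/

theorem leftReg_apply {G : Type} [Group G] (g : G) (f : EllTwo G) (x : G) :
    leftReg G g f x = f (g⁻¹ * x) := rfl

theorem EllTwo.tendsto_cofinite {G : Type} (f : EllTwo G) :
    Tendsto (fun x => f x) cofinite (𝓝 0) := by
  have h := ((lp.memℓp f).summable (by norm_num)).tendsto_cofinite_zero
  rw [tendsto_zero_iff_norm_tendsto_zero]
  have h2 := h.sqrt
  simpa using h2

/-- For each `x`, `f` is constant on the infinitely many points `s⁻¹x`, but its values tend to zero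
at infinity. -/
theorem EllTwo.eq_zero_of_invariant {G : Type} [Group G] {S : Set G} (hS : S.Infinite)
    {f : EllTwo G} (hf : ∀ s ∈ S, leftReg G s f = f) : f = 0 := by
  ext x
  have hinf : Infinite S := hS.to_subtype
  have hinj : Function.Injective (fun s : S => (s : G)⁻¹ * x) := fun s t h =>
    Subtype.ext (by simpa using h)
  have h := f.tendsto_cofinite.comp hinj.tendsto_cofinite
  have h2 : ((fun x => f x) ∘ fun s : S => (s : G)⁻¹ * x) = fun _ => f x := by
    funext s
    exact congrArg (fun f : EllTwo G => f x) (hf s s.2)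
  rw [h2] at h
  exact tendsto_nhds_unique tendsto_const_nhds h

/-- If `w` has infinite order, then the translate of `η` by `w` minus `η` cannot have nonnegative
real part along the powers of `w` without vanishing there. -/
theorem EllTwo.re_translate_sub_eq_zero {G : Type} [Group G] {w : G}
    (hw : ∀ n : ℕ, n ≠ 0 → w ^ n ≠ 1) (η : EllTwo G)
    (h : ∀ k : ℤ, 0 ≤ ((leftReg G w η - η) (w ^ k)).re) : ((leftReg G w η - η) 1).re = 0 := by
  have hinj : Function.Injective (fun k : ℤ => w ^ k) := by
    rw [injective_zpow_iff_not_isOfFinOrder, isOfFinOrder_iff_pow_eq_one]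
    rintro ⟨n, hn, h1⟩
    exact hw n hn.ne' h1
  let u : ℤ → ℝ := fun k => (η (w ^ k)).re
  have hstep : ∀ k : ℤ, ((leftReg G w η - η) (w ^ k)).re = u (k - 1) - u k := by
    intro k
    have : w⁻¹ * w ^ k = w ^ (k - 1) := by rw [zpow_sub_one, ← zpow_neg_one, ← zpow_add,
      ← zpow_add, add_comm]
    simp [u, leftReg_apply, this]
  have hanti : Antitone u := antitone_int_of_succ_le fun n => by
    have := h (n + 1)
    rw [hstep, add_sub_cancel_right] at this
    linarith
  have hlim : Tendsto u cofinite (𝓝 0) := by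
    have : Tendsto u cofinite (𝓝 (0 : ℂ).re) :=
      (Complex.continuous_re.tendsto _).comp (η.tendsto_cofinite.comp hinj.tendsto_cofinite)
    rwa [Complex.zero_re] at this
  -- An antitone sequence with limit `0` at both `-∞` and `+∞` is identically zero.
  rw [Int.cofinite_eq, tendsto_sup] at hlim
  have hu : ∀ k, u k = 0 := fun k =>
    le_antisymm (hanti.ge_of_tendsto hlim.1 k) (hanti.le_of_tendsto hlim.2 k)
  have := hstep 0
  rw [zpow_zero, hu, hu] at this
  simpa using this

/-- The characteristic function of a finite set. -/
def EllTwo.indicator {G : Type} (S : Set G) (hS : S.Finite) : EllTwo G :=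
  ⟨S.indicator 1, (memℓp_zero (hS.subset (by
    intro x hx
    by_contra h
    exact hx (Set.indicator_of_notMem h _)))).of_exponent_ge (by norm_num)⟩

theorem EllTwo.indicator_of_mem {G : Type} {S : Set G} (hS : S.Finite) {x : G} (hx : x ∈ S) :
    EllTwo.indicator S hS x = 1 := Set.indicator_of_mem hx _

theorem EllTwo.indicator_of_notMem {G : Type} {S : Set G} (hS : S.Finite) {x : G} (hx : x ∉ S) :
    EllTwo.indicator S hS x = 0 := Set.indicator_of_notMem hx _

theorem EllTwo.indicator_re_nonneg {G : Type} {S : Set G} (hS : S.Finite) (x : G) :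
    0 ≤ (EllTwo.indicator S hS x).re := by
  by_cases hx : x ∈ S
  · simp [indicator_of_mem hS hx]
  · simp [indicator_of_notMem hS hx]

theorem EllTwo.leftReg_indicator {G : Type} [Group G] (K : Subgroup G) (hK : (K : Set G).Finite)
    {g : G} (hg : g ∈ K) : leftReg G g (indicator K hK) = indicator K hK := by
  ext x
  rw [leftReg_apply]
  by_cases hx : x ∈ K
  · rw [indicator_of_mem hK hx, indicator_of_mem hK (mul_mem (inv_mem hg) hx)]
  · rw [indicator_of_notMem hK hx, indicator_of_notMem hK]
    intro h
    apply hx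
    simpa using mul_mem hg h

/-! ### Cohomology of the fundamental group -/

namespace GraphOfGroups

variable {V A : Type} {X : GraphOfGroups V A} {T : Set A}

theorem IsMaximalTree.subsingleton_H1 [Nonempty A] (hT : X.IsMaximalTree T)
    (hV : ∀ v : V, Subsingleton (groupCohomology.H1 (ellTwoRes (X.ofVertex T v))))
    (hE : ∀ e : A, Infinite (X.edgeGroup e)) :
    Subsingleton (groupCohomology.H1 (ellTwoRep (X.PiOne T))) := by
  have hrange : ∀ e, (Set.range fun g : X.edgeGroup e =>
      X.ofVertex T _ (X.toSrc e g)).Infinite := fun e =>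
    have := hE e
    Set.infinite_range_of_injective ((hT.ofVertex_injective _).comp (X.toSrc_injective e))
  rw [groupCohomology.subsingleton_H1_iff]
  intro c hc
  replace hc : ∀ g h, c (g * h) = leftReg (X.PiOne T) g (c h) + c g := hc
  have hξ : ∀ v, ∃ ξ : EllTwo (X.PiOne T), ∀ g, c (X.ofVertex T v g)
      = leftReg (X.PiOne T) (X.ofVertex T v g) ξ - ξ := fun v =>
    (groupCohomology.subsingleton_H1_iff _).1 (hV v) (fun g => c (X.ofVertex T v g))
      (fun g h => by rw [map_mul]; exact hc _ _)
  choose ξ hξ using hξ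
  -- Evaluating `c` on both sides of the edge relation shows that the difference of the two sides is
  -- fixed by the infinite image of the edge group.
  have key : ∀ e, c (X.stable T e)
      = leftReg (X.PiOne T) (X.stable T e) (ξ (X.tgt e)) - ξ (X.src e) := by
    intro e
    rw [← sub_eq_zero]
    refine EllTwo.eq_zero_of_invariant (hrange e) ?_
    rintro _ ⟨g, rfl⟩
    have h1 := X.stable_mul_ofVertex T e g
    have h2 := congrArg c h1
    have h3 := congrArg (fun y => leftReg (X.PiOne T) y (ξ (X.tgt e))) h1
    simp only [map_mul, Module.End.mul_apply] at h3
    rw [hc, hc, hξ, hξ, map_sub, h3] at h2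
    rw [map_sub, map_sub, ← sub_eq_zero, ← sub_eq_zero.2 h2.symm]
    abel
  have hconst : ∀ e ∈ T, ξ (X.src e) = ξ (X.tgt e) := by
    intro e he
    have h0 : c 1 = 0 := by simpa using hc 1 1
    have := key e
    rw [X.stable_eq_one he, h0, map_one, Module.End.one_apply, eq_comm, sub_eq_zero] at this
    exact this.symm
  have e₀ : A := Classical.arbitrary A
  have hall : ∀ v, ξ v = ξ (X.src e₀) := fun v => hT.eq_of_forall_eq ξ hconst v _
  refine ⟨ξ (X.src e₀), fun g => cocycle_eq_of_generators (leftReg (X.PiOne T)) hc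
    (fun v g => ?_) (fun e => ?_) g⟩
  · rw [hξ, hall]
  · rw [key, hall (X.tgt e), hall (X.src e)]

/-- The image of an edge group in the fundamental group, through the origin of the edge. -/
def edgeImage (X : GraphOfGroups V A) (T : Set A) (e : A) : Subgroup (X.PiOne T) :=
  ((X.ofVertex T (X.src e)).comp (X.toSrc e)).range

theorem finite_edgeImage (X : GraphOfGroups V A) (T : Set A) (e : A) [Finite (X.edgeGroup e)] :
    (X.edgeImage T e : Set (X.PiOne T)).Finite := by
  rw [edgeImage, MonoidHom.coe_range]
  exact Set.finite_range _

theorem nontrivial_H1_of_notMem {e : A} [Finite (X.edgeGroup e)] (he : e ∉ T) :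
    Nontrivial (groupCohomology.H1 (ellTwoRep (X.PiOne T))) := by
  classical
  rw [← not_subsingleton_iff_nontrivial, groupCohomology.subsingleton_H1_iff]
  intro h
  let χ := EllTwo.indicator _ (X.finite_edgeImage T e)
  -- This cocycle vanishes on all vertex groups and equals `χ` at the stable letter of `e`.
  obtain ⟨c, hc, -, ht⟩ := X.exists_cocycle (T := T) (leftReg (X.PiOne T)) (fun _ => 0)
    (fun f => if f = e then χ else 0)
    (fun f g => by
      by_cases hf : f = e
      · subst hf
        rw [if_pos rfl]
        exact EllTwo.leftReg_indicator _ _ ⟨g, rfl⟩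
      · rw [if_neg hf, map_zero])
    (fun f hf => by rw [if_neg (by rintro rfl; exact he hf)]; simp)
  obtain ⟨η, hη⟩ := h c hc
  have h1 : leftReg (X.PiOne T) (X.stable T e) η - η = χ := by
    refine (hη _).symm.trans ?_
    rw [ht]
    simp
  have h2 := EllTwo.re_translate_sub_eq_zero (w := X.stable T e) (fun n hn h3 => by
    obtain ⟨Φ, hΦ⟩ := X.exists_hom_int he
    have := congrArg Φ h3
    rw [map_pow, hΦ, map_one Φ, ← ofAdd_nsmul] at this
    exact hn (by simpa using this)) η
    (fun k => by rw [h1]; exact EllTwo.indicator_re_nonneg _ _)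
  rw [h1, EllTwo.indicator_of_mem _ (one_mem (X.edgeImage T e))] at h2
  simp at h2

theorem IsMaximalTree.nontrivial_H1_of_mem (hT : X.IsMaximalTree T) {e : A}
    [Finite (X.edgeGroup e)] (he : e ∈ T)
    {a : X.vertexGroup (X.src e)} {b : X.vertexGroup (X.tgt e)}
    (ha : a ∉ (X.toSrc e).range) (hb : b ∉ (X.toTgt e).range) :
    Nontrivial (groupCohomology.H1 (ellTwoRep (X.PiOne T))) := by
  classical
  rw [← not_subsingleton_iff_nontrivial, groupCohomology.subsingleton_H1_iff]
  intro h
  let χ := EllTwo.indicator _ (X.finite_edgeImage T e)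
  -- The potential jumps by `χ` across `e` and is constant along all other tree edges: on the vertex
  -- groups the cocycle is the coboundary of one vector on each side of `e`.
  obtain ⟨ζ, hζ⟩ := hT.exists_potential (H := Multiplicative (EllTwo (X.PiOne T)))
    (fun f => Multiplicative.ofAdd (if f = e then χ else 0))
  replace hζ : ∀ f ∈ T, (ζ (X.tgt f)).toAdd = (ζ (X.src f)).toAdd + if f = e then χ else 0 := hζ
  obtain ⟨c, hc, hv, -⟩ := X.exists_cocycle (T := T) (leftReg (X.PiOne T)) (fun v => (ζ v).toAdd)
    (fun f => - if f = e then χ else 0)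
    (fun f g => by
      by_cases hf : f = e
      · subst hf
        rw [if_pos rfl, map_neg]
        exact congrArg _ (EllTwo.leftReg_indicator _ _ ⟨g, rfl⟩)
      · rw [if_neg hf, neg_zero, map_zero])
    (fun f hf => by rw [hζ f hf]; abel)
  obtain ⟨η, hη⟩ := h c hc
  replace hη : ∀ g, c g = leftReg (X.PiOne T) g η - η := hη
  have hχ := hζ e he
  rw [if_pos rfl] at hχ
  have h1 := (hη _).symm.trans (hv _ a)
  have h2 := (hη _).symm.trans (hv _ b)
  set α := X.ofVertex T _ a
  set β := X.ofVertex T _ b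
  set θ := η - (ζ (X.src e)).toAdd with hθ
  have h3 : leftReg (X.PiOne T) α θ = θ := by
    rw [hθ, map_sub, ← sub_eq_zero, ← sub_eq_zero.2 h1]
    abel
  have h4 : leftReg (X.PiOne T) β θ - θ = leftReg (X.PiOne T) β χ - χ := by
    rw [hχ, map_add] at h2
    rw [hθ, map_sub, ← sub_eq_zero, ← sub_eq_zero.2 h2]
    abel
  have h5 : leftReg (X.PiOne T) (β * α) θ - θ = leftReg (X.PiOne T) β χ - χ := by
    rw [map_mul, Module.End.mul_apply, h3, h4]
  -- The translate of `χ` by `β` is supported on `β` times the image of the edge group, which by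
  -- normal forms contains no power of `β * α`. So only `-χ` survives there.
  have h6 : ∀ k : ℤ, (leftReg (X.PiOne T) (β * α) θ - θ) ((β * α) ^ k) = - χ ((β * α) ^ k) := by
    intro k
    rw [h5, lp.coeFn_sub, Pi.sub_apply, leftReg_apply, EllTwo.indicator_of_notMem, zero_sub]
    rintro ⟨g, hg⟩
    refine hT.zpow_ne he ha hb k g ?_
    have h7 := X.stable_mul_ofVertex T e g
    rw [X.stable_eq_one he, one_mul, mul_one] at h7
    rw [h7, ← inv_mul_eq_iff_eq_mul]
    exact hg.symm
  have h8 := EllTwo.re_translate_sub_eq_zero (fun n hn => hT.pow_ne_one he ha hb hn) (-θ)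
    (fun k => by
      rw [map_neg, ← neg_sub', lp.coeFn_neg, Pi.neg_apply, h6, neg_neg]
      exact EllTwo.indicator_re_nonneg _ _)
  have h9 := h6 0
  rw [zpow_zero, EllTwo.indicator_of_mem _ (one_mem (X.edgeImage T e))] at h9
  rw [map_neg, ← neg_sub', lp.coeFn_neg, Pi.neg_apply, h9] at h8
  simp at h8

end GraphOfGroups

theorem Subgroup.exists_notMem_of_two_le {G : Type*} [Group G] {K : Subgroup G}
    (h : 2 ≤ ENat.card (G ⧸ K)) : ∃ g, g ∉ K := by
  by_contra! hK
  have : Subsingleton (G ⧸ K) := by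
    rw [QuotientGroup.subsingleton_iff]
    exact (Subgroup.eq_top_iff' K).2 hK
  have := (ENat.card_le_one_iff_subsingleton (G ⧸ K)).2 this
  exact absurd (h.trans this) (by norm_num)

/-! ### The regular representation is unitary -/

theorem EllTwo.summable_sq {G : Type} (f : EllTwo G) : Summable fun x => ‖f x‖ ^ 2 := by
  simpa using (lp.memℓp f).summable (by norm_num)

theorem EllTwo.norm_sq_eq {G : Type} (f : EllTwo G) : ‖f‖ ^ 2 = ∑' x, ‖f x‖ ^ 2 := by
  simpa using lp.norm_rpow_eq_tsum (by norm_num) f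

theorem EllTwo.norm_leftReg {G : Type} [Group G] (g : G) (f : EllTwo G) :
    ‖leftReg G g f‖ = ‖f‖ := by
  rw [← sq_eq_sq₀ (norm_nonneg _) (norm_nonneg _), norm_sq_eq, norm_sq_eq]
  exact (Equiv.mulLeft g⁻¹).tsum_eq fun x => ‖f x‖ ^ 2

theorem EllTwo.inner_leftReg {G : Type} [Group G] (g : G) (x y : EllTwo G) :
    inner ℂ (leftReg G g x) y = inner ℂ x (leftReg G g⁻¹ y) := by
  rw [lp.inner_eq_tsum, lp.inner_eq_tsum, ← (Equiv.mulLeft g).tsum_eq]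
  simp [leftReg_apply]

/-- Translation by a group element as a bounded operator. -/
def leftRegL (G : Type) [Group G] (g : G) : EllTwo G →L[ℂ] EllTwo G :=
  (leftReg G g).mkContinuous 1 fun f => by rw [one_mul, EllTwo.norm_leftReg]

/-! ### Almost invariant vectors and amenability -/

/-- The restriction of a square-summable function to a set, extended by zero. -/
def EllTwo.restrict {G : Type} (s : Set G) (f : EllTwo G) : EllTwo G :=
  ⟨s.indicator f, memℓp_gen (by
    refine Summable.of_nonneg_of_le (fun x => by positivity) (fun x => ?_) f.summable_sq
    by_cases hx : x ∈ s <;> simp [hx])⟩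

theorem EllTwo.norm_sq_restrict {G : Type} (s : Set G) (f : EllTwo G) :
    ‖restrict s f‖ ^ 2 = ∑' x, s.indicator (fun x => ‖f x‖ ^ 2) x := by
  rw [norm_sq_eq]
  refine tsum_congr fun x => ?_
  change ‖s.indicator f x‖ ^ 2 = _
  by_cases hx : x ∈ s <;> simp [hx]

theorem EllTwo.norm_restrict_le {G : Type} (s : Set G) (f : EllTwo G) : ‖restrict s f‖ ≤ ‖f‖ := by
  rw [← sq_le_sq₀ (norm_nonneg _) (norm_nonneg _), norm_sq_restrict, norm_sq_eq]
  exact Summable.tsum_le_tsum (fun x => Set.indicator_le_self' (fun _ _ => by positivity) x)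
    (f.summable_sq.indicator s) f.summable_sq

theorem EllTwo.restrict_univ {G : Type} (f : EllTwo G) : restrict Set.univ f = f := by
  ext x
  exact congrFun (Set.indicator_univ _) x

theorem EllTwo.norm_sq_restrict_union {G : Type} {s t : Set G} (h : Disjoint s t) (f : EllTwo G) :
    ‖restrict (s ∪ t) f‖ ^ 2 = ‖restrict s f‖ ^ 2 + ‖restrict t f‖ ^ 2 := by
  rw [norm_sq_restrict, norm_sq_restrict, norm_sq_restrict, Set.indicator_union_of_disjoint h]
  exact (f.summable_sq.indicator s).tsum_add (f.summable_sq.indicator t)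

theorem EllTwo.restrict_sub {G : Type} (s : Set G) (f g : EllTwo G) :
    restrict s (f - g) = restrict s f - restrict s g := by
  ext x
  exact congrFun (Set.indicator_sub s f g) x

theorem EllTwo.restrict_image_mul {G : Type} [Group G] (g : G) (s : Set G) (f : EllTwo G) :
    restrict ((fun x => g * x) '' s) f = leftReg G g (restrict s (leftReg G g⁻¹ f)) := by
  ext x
  change Set.indicator _ f x = s.indicator (leftReg G g⁻¹ f) (g⁻¹ * x)
  have : x ∈ (fun x => g * x) '' s ↔ g⁻¹ * x ∈ s := by
    rw [Set.image_mul_left]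
    rfl
  by_cases hx : g⁻¹ * x ∈ s
  · rw [Set.indicator_of_mem (this.2 hx), Set.indicator_of_mem hx, leftReg_apply]
    simp
  · rw [Set.indicator_of_notMem (this.not.2 hx), Set.indicator_of_notMem hx]

theorem EllTwo.abs_norm_sq_restrict_image_sub_le {G : Type} [Group G] (g : G) (s : Set G)
    (f : EllTwo G) :
    |‖restrict ((fun x => g * x) '' s) f‖ ^ 2 - ‖restrict s f‖ ^ 2|
      ≤ 2 * ‖f‖ * ‖leftReg G g⁻¹ f - f‖ := by
  rw [restrict_image_mul, norm_leftReg, sq_sub_sq, abs_mul]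
  have h1 : |‖restrict s (leftReg G g⁻¹ f)‖ + ‖restrict s f‖| ≤ 2 * ‖f‖ := by
    rw [abs_of_nonneg (by positivity)]
    have := norm_restrict_le s (leftReg G g⁻¹ f)
    rw [norm_leftReg] at this
    linarith [norm_restrict_le s f]
  have h2 : |‖restrict s (leftReg G g⁻¹ f)‖ - ‖restrict s f‖| ≤ ‖leftReg G g⁻¹ f - f‖ := by
    refine (abs_norm_sub_norm_le _ _).trans ?_
    rw [← restrict_sub]
    exact norm_restrict_le _ _
  exact mul_le_mul h1 h2 (abs_nonneg _) (by positivity)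

/-- A net of unit vectors that is asymptotically invariant yields an invariant mean. -/
theorem amenableGroup_of_tendsto {G ι : Type} [Group G] (l : Filter ι) [l.NeBot]
    (η : ι → EllTwo G) (hη : ∀ i, ‖η i‖ = 1)
    (hl : ∀ g, Tendsto (fun i => ‖leftReg G g (η i) - η i‖) l (𝓝 0)) : AmenableGroup G := by
  let U := Ultrafilter.of l
  -- The mean of `s` is the ultrafilter limit of the mass that the probability density `|η i|²`
  -- gives to `s`.
  let μ : Set G → ι → ℝ := fun s i => ‖EllTwo.restrict s (η i)‖ ^ 2
  have hμ : ∀ s, ∃ m, 0 ≤ m ∧ Tendsto (μ s) U (𝓝 m) := by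
    intro s
    obtain ⟨m, hm, hlim⟩ := (isCompact_Icc (a := (0 : ℝ)) (b := 1)).ultrafilter_le_nhds
      (U.map (μ s)) (by
        rw [le_principal_iff]
        refine Filter.mem_map.2 (Filter.univ_mem' fun i => ⟨sq_nonneg _, ?_⟩)
        have := EllTwo.norm_restrict_le s (η i)
        rw [hη] at this
        exact pow_le_one₀ (norm_nonneg _) this)
    exact ⟨m, hm.1, hlim⟩
  choose m hm hlim using hμ
  refine ⟨m, hm, ?_, fun s t hst => ?_, fun g s => ?_⟩
  · refine tendsto_nhds_unique (hlim _) ?_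
    have : μ Set.univ = fun _ => 1 := by
      funext i
      simp [μ, EllTwo.restrict_univ, hη]
    rw [this]
    exact tendsto_const_nhds
  · refine tendsto_nhds_unique (hlim _) ?_
    have : μ (s ∪ t) = fun i => μ s i + μ t i :=
      funext fun i => EllTwo.norm_sq_restrict_union hst _
    rw [this]
    exact (hlim s).add (hlim t)
  · have h1 : Tendsto (fun i => μ ((fun x => g * x) '' s) i - μ s i) U (𝓝 0) := by
      refine squeeze_zero_norm (a := fun i => 2 * ‖leftReg G g⁻¹ (η i) - η i‖) (fun i => ?_) ?_
      · have := EllTwo.abs_norm_sq_restrict_image_sub_le g s (η i)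
        rw [hη, mul_one] at this
        exact this
      · simpa using ((hl g⁻¹).mono_left (Ultrafilter.of_le l)).const_mul 2
    exact sub_eq_zero.1 (tendsto_nhds_unique ((hlim _).sub (hlim _)) h1)

/-- A non-amenable group has a finite subset which moves all vectors of the regular
representation uniformly. -/
theorem exists_spectral_gap {G : Type} [Group G] (hG : ¬ AmenableGroup G) :
    ∃ (F : Finset G) (ε : ℝ), 0 < ε ∧
      ∀ η : EllTwo G, ∃ g ∈ F, ε * ‖η‖ ≤ ‖leftReg G g η - η‖ := by
  classical
  by_contra! h
  apply hG
  have h2 : ∀ p : Finset G × ℕ, ∃ η : EllTwo G, ‖η‖ = 1 ∧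
      ∀ g ∈ p.1, ‖leftReg G g η - η‖ ≤ 1 / (p.2 + 1 : ℝ) := by
    rintro ⟨F, n⟩
    have hn : (0 : ℝ) < 1 / (n + 1) := by positivity
    -- Adding `1` makes the finite set nonempty, so the strict inequality forces `η ≠ 0`.
    obtain ⟨η, hη⟩ := h (insert 1 F) _ hn
    have h0 : 0 < ‖η‖ := by
      have := (norm_nonneg _).trans_lt (hη 1 (Finset.mem_insert_self 1 F))
      exact (mul_pos_iff_of_pos_left hn).1 this
    refine ⟨((‖η‖⁻¹ : ℝ) : ℂ) • η, by simp [norm_smul, h0.ne'], fun g hg => ?_⟩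
    rw [map_smul, ← smul_sub, norm_smul, Complex.norm_real, Real.norm_of_nonneg (by positivity),
      inv_mul_le_iff₀ h0, mul_comm]
    exact (hη g (Finset.mem_insert_of_mem hg)).le
  choose η hη1 hη2 using h2
  refine amenableGroup_of_tendsto (atTop : Filter (Finset G × ℕ)) η hη1 fun g => ?_
  have hlim : Tendsto (fun p : Finset G × ℕ => 1 / (p.2 + 1 : ℝ)) atTop (𝓝 0) := by
    rw [← prod_atTop_atTop_eq]
    exact tendsto_one_div_add_atTop_nhds_zero_nat.comp tendsto_snd
  refine squeeze_zero' (Eventually.of_forall fun _ => norm_nonneg _) ?_ hlim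
  filter_upwards [eventually_ge_atTop (({g}, 0) : Finset G × ℕ)] with p hp
  exact hη2 p g (hp.1 (Finset.mem_singleton_self g))

/-! ### Coboundaries on a finite set -/

/-- The restrictions of the coboundaries to a finite set of group elements. -/
def finiteCoboundary {G : Type} [Group G] (F : Finset G) :
    EllTwo G →L[ℂ] PiLp 2 (fun _ : F => EllTwo G) :=
  (PiLp.continuousLinearEquiv 2 ℂ (fun _ : F => EllTwo G)).symm.toContinuousLinearMap.comp
    (ContinuousLinearMap.pi fun g : F => leftRegL G g - ContinuousLinearMap.id ℂ _)

theorem finiteCoboundary_apply {G : Type} [Group G] (F : Finset G) (η : EllTwo G) (g : F) :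
    finiteCoboundary F η g = leftReg G g η - η := rfl

theorem antilipschitz_finiteCoboundary {G : Type} [Group G] {F : Finset G} {ε : ℝ} (hε : 0 < ε)
    (hF : ∀ η : EllTwo G, ∃ g ∈ F, ε * ‖η‖ ≤ ‖leftReg G g η - η‖) :
    AntilipschitzWith (Real.toNNReal ε⁻¹) (finiteCoboundary F) := by
  refine ContinuousLinearMap.antilipschitz_of_bound _ fun η => ?_
  rw [Real.coe_toNNReal _ (by positivity)]
  obtain ⟨g, hg, h⟩ := hF η
  have h2 := PiLp.norm_apply_le (finiteCoboundary F η) ⟨g, hg⟩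
  rw [finiteCoboundary_apply] at h2
  rw [← div_eq_inv_mul, le_div_iff₀ hε, mul_comm]
  exact h.trans h2

theorem isClosed_range_finiteCoboundary {G : Type} [Group G] {F : Finset G} {ε : ℝ} (hε : 0 < ε)
    (hF : ∀ η : EllTwo G, ∃ g ∈ F, ε * ‖η‖ ≤ ‖leftReg G g η - η‖) :
    IsClosed ((LinearMap.range (finiteCoboundary F).toLinearMap :
      Submodule ℂ (PiLp 2 (fun _ : F => EllTwo G))) : Set (PiLp 2 (fun _ : F => EllTwo G))) :=
  (antilipschitz_finiteCoboundary hε hF).isClosed_range (finiteCoboundary F).uniformContinuous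

theorem mem_cocyclesVN {G : Type} [Group G] {c : G → EllTwo G} :
    c ∈ cocyclesVN G ↔ ∀ g h, c (g * h) = leftReg G g (c h) + c g :=
  groupCohomology.mem_cocycles₁_iff (A := ellTwoRep G) c

theorem mem_coboundariesVN {G : Type} [Group G] {c : G → EllTwo G} :
    c ∈ coboundariesVN G ↔ ∃ η, ∀ g, c g = leftReg G g η - η :=
  ⟨fun ⟨η, h⟩ => ⟨η, fun g => (congrFun h g).symm⟩,
    fun ⟨η, h⟩ => ⟨η, funext fun g => (h g).symm⟩⟩

/-- On every finite set containing `F`, restrictions of coboundaries form a closed space, so there a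
limit is the coboundary of some vector. The gap makes this vector unique already on `F`, hence the
same for all finite sets. -/
theorem topologicalClosure_coboundariesVN {G : Type} [Group G] (hG : ¬ AmenableGroup G) :
    (coboundariesVN G).topologicalClosure = coboundariesVN G := by
  classical
  refine le_antisymm (fun c hc => ?_) (Submodule.le_topologicalClosure _)
  obtain ⟨F, ε, hε, hF⟩ := exists_spectral_gap hG
  have key : ∀ F' : Finset G, F ⊆ F' → ∃ η, ∀ g ∈ F', c g = leftReg G g η - η := by
    intro F' hFF'
    let r : (G → EllTwo G) → PiLp 2 (fun _ : F' => EllTwo G) :=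
      fun c => WithLp.toLp 2 fun g : F' => c g
    have hr : Continuous r :=
      (PiLp.continuous_toLp 2 _).comp (continuous_pi fun g => continuous_apply (g : G))
    have h1 : r c ∈ closure ((LinearMap.range (finiteCoboundary F').toLinearMap :
        Submodule ℂ (PiLp 2 (fun _ : F' => EllTwo G))) : Set (PiLp 2 (fun _ : F' => EllTwo G))) := by
      refine map_mem_closure hr hc ?_
      rintro d hd
      obtain ⟨η, hη⟩ := mem_coboundariesVN.1 hd
      refine ⟨η, ?_⟩
      ext1 g
      exact (hη g).symm
    rw [(isClosed_range_finiteCoboundary hε (fun η => by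
      obtain ⟨g, hg, h⟩ := hF η
      exact ⟨g, hFF' hg, h⟩)).closure_eq] at h1
    obtain ⟨η, hη⟩ := h1
    refine ⟨η, fun g hg => ?_⟩
    have := congrArg (fun x : PiLp 2 (fun _ : F' => EllTwo G) => x ⟨g, hg⟩) hη
    exact this.symm
  obtain ⟨η, hη⟩ := key F subset_rfl
  refine mem_coboundariesVN.2 ⟨η, fun g => ?_⟩
  obtain ⟨θ, hθ⟩ := key (insert g F) (Finset.subset_insert g F)
  have : η = θ := by
    apply (antilipschitz_finiteCoboundary hε hF).injective
    ext1 x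
    change leftReg G x η - η = leftReg G x θ - θ
    rw [← hη x x.2, ← hθ x (Finset.mem_insert_of_mem x.2)]
  rw [this]
  exact hθ g (Finset.mem_insert_self g F)

/-! ### The group von Neumann algebra -/

theorem groupVN_adjoint_leftReg {G : Type} [Group G] (S : GroupVN G) (g : G) (f : EllTwo G) :
    S.op.adjoint (leftReg G g f) = leftReg G g (S.op.adjoint f) := by
  refine ext_inner_right ℂ fun y => ?_
  rw [ContinuousLinearMap.adjoint_inner_left, EllTwo.inner_leftReg, EllTwo.inner_leftReg,
    ContinuousLinearMap.adjoint_inner_left]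
  exact congrArg (inner ℂ f) (S.2 g⁻¹ y).symm

/-- A cocycle class orthogonal to the coboundaries on a finite set with a spectral gap is not
annihilated by any operator that does not annihilate the cocycle. -/
theorem smul_eq_zero_of_mem_coboundariesVN {G : Type} [Group G] {F : Finset G} {ε : ℝ}
    (hε : 0 < ε) (hF : ∀ η : EllTwo G, ∃ g ∈ F, ε * ‖η‖ ≤ ‖leftReg G g η - η‖)
    {c : G → EllTwo G} (hc : ∀ η, inner ℂ (finiteCoboundary F η)
      (WithLp.toLp 2 fun g : F => c g : PiLp 2 (fun _ : F => EllTwo G)) = 0)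
    (S : GroupVN G) (h : S • c ∈ coboundariesVN G) : S • c = 0 := by
  obtain ⟨η, hη⟩ := mem_coboundariesVN.1 h
  replace hη : ∀ g, S.op (c g) = leftReg G g η - η := hη
  have h0 : finiteCoboundary F η = 0 := by
    -- On `F`, writing `∂` for the coboundary, `⟨∂η, ∂η⟩ = ⟨∂η, S c⟩ = ⟨∂(S*η), c⟩ = 0`, since `S*`
    -- also commutes with translations.
    rw [← inner_self_eq_zero (𝕜 := ℂ), ← hc (S.op.adjoint η), PiLp.inner_apply, PiLp.inner_apply]
    refine Finset.sum_congr rfl fun g _ => ?_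
    rw [finiteCoboundary_apply, finiteCoboundary_apply, ← groupVN_adjoint_leftReg, ← map_sub,
      ContinuousLinearMap.adjoint_inner_left, hη]
  have h1 : η = 0 :=
    (antilipschitz_finiteCoboundary hε hF).injective (h0.trans (map_zero _).symm)
  funext g
  change S.op (c g) = 0
  rw [hη, h1, map_zero, sub_zero]

/-- The restriction of `c` to `F` has a projection onto the closed range of coboundaries; subtract
from `c` the global coboundary of a vector realizing it. -/
theorem exists_orthogonal_cocycle {G : Type} [Group G] {F : Finset G} {ε : ℝ}
    (hε : 0 < ε) (hF : ∀ η : EllTwo G, ∃ g ∈ F, ε * ‖η‖ ≤ ‖leftReg G g η - η‖)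
    {c : G → EllTwo G} (hc : c ∈ cocyclesVN G) (hc' : c ∉ coboundariesVN G) :
    ∃ d ∈ cocyclesVN G, d ∉ coboundariesVN G ∧ ∀ η, inner ℂ (finiteCoboundary F η)
      (WithLp.toLp 2 fun g : F => d g : PiLp 2 (fun _ : F => EllTwo G)) = 0 := by
  let K := LinearMap.range (finiteCoboundary F).toLinearMap
  have : CompleteSpace K := (isClosed_range_finiteCoboundary hε hF).completeSpace_coe
  let r : PiLp 2 (fun _ : F => EllTwo G) := WithLp.toLp 2 fun g : F => c g
  obtain ⟨θ, hθ⟩ : K.starProjection r ∈ K := K.starProjection_apply_mem r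
  let b : G → EllTwo G := fun g => leftReg G g θ - θ
  have hb : b ∈ coboundariesVN G := mem_coboundariesVN.2 ⟨θ, fun _ => rfl⟩
  have hb' : b ∈ cocyclesVN G := mem_cocyclesVN.2 fun g h => by simp [b]
  refine ⟨c - b, sub_mem hc hb', fun h => hc' ?_, fun η => ?_⟩
  · simpa using add_mem h hb
  · have h1 : (WithLp.toLp 2 fun g : F => (c - b) g : PiLp 2 (fun _ : F => EllTwo G))
        = r - K.starProjection r := by
      rw [← hθ]
      rfl
    rw [h1]
    exact K.sub_starProjection_mem_orthogonal r _ ⟨η, rfl⟩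

theorem leftReg_mem_orthogonal {G : Type} [Group G] {K : Submodule ℂ (EllTwo G)}
    (hK : ∀ g, ∀ x ∈ K, leftReg G g x ∈ K) (g : G) {x : EllTwo G} (hx : x ∈ Kᗮ) :
    leftReg G g x ∈ Kᗮ := by
  intro y hy
  have h := hx _ (hK g⁻¹ y hy)
  rwa [EllTwo.inner_leftReg, inv_inv] at h

/-- The orthogonal projection to an invariant subspace, as an element of the group von Neumann
algebra. -/
def invariantProjection {G : Type} [Group G] (K : Submodule ℂ (EllTwo G))
    [K.HasOrthogonalProjection] (hK : ∀ g, ∀ x ∈ K, leftReg G g x ∈ K) : GroupVN G :=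
  ⟨K.starProjection, fun g f =>
    K.eq_starProjection_of_mem_orthogonal (hK g _ (K.starProjection_apply_mem f)) (by
      rw [← map_sub]
      exact leftReg_mem_orthogonal hK g (K.sub_starProjection_mem_orthogonal f))⟩

open scoped Classical in
theorem vnTrace_invariantProjection {G : Type} [Group G]
    (K : Submodule ℂ (EllTwo G)) [K.HasOrthogonalProjection]
    (hK : ∀ g, ∀ x ∈ K, leftReg G g x ∈ K) :
    (vnTrace (invariantProjection K hK)).re
      = ‖K.starProjection (lp.single 2 (1 : G) (1 : ℂ))‖ ^ 2 := by
  have h1 : vnTrace (invariantProjection K hK)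
      = K.starProjection (lp.single 2 (1 : G) (1 : ℂ)) 1 := rfl
  set δ : EllTwo G := lp.single 2 (1 : G) (1 : ℂ)
  have h2 : inner ℂ δ (K.starProjection δ) = K.starProjection δ 1 := by
    rw [lp.inner_single_left]
    simp
  have h3 : inner ℂ δ (K.starProjection δ)
      = inner ℂ (K.starProjection δ) (K.starProjection δ) := by
    rw [K.inner_starProjection_left_eq_right, K.starProjection_eq_self_iff.2
      (K.starProjection_apply_mem δ)]
  rw [h1, ← h2, h3, norm_sq_eq_re_inner (𝕜 := ℂ)]
  rfl

/-! ### Positivity and vanishing of the first Betti number -/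

theorem bettiOne_pos {G : Type} [Group G] (hG : ¬ AmenableGroup G)
    (hH : Nontrivial (groupCohomology.H1 (ellTwoRep G))) : 0 < bettiOne G := by
  classical
  obtain ⟨F, ε, hε, hF⟩ := exists_spectral_gap hG
  obtain ⟨c₀, hc₀, hc₀'⟩ : ∃ c ∈ cocyclesVN G, c ∉ coboundariesVN G := by
    by_contra! h
    rw [← not_subsingleton_iff_nontrivial, groupCohomology.subsingleton_H1_iff] at hH
    exact hH fun c hc => mem_coboundariesVN.1 (h c (mem_cocyclesVN.2 hc))
  obtain ⟨c, hc, hc', horth⟩ := exists_orthogonal_cocycle hε hF hc₀ hc₀'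
  let S : Set (EllTwo G) := {x | ∃ g h, leftReg G g (c h) = x}
  let U : Submodule ℂ (EllTwo G) := Submodule.span ℂ S
  have hU : ∀ g, ∀ x ∈ U, leftReg G g x ∈ U := by
    intro g
    change U ≤ U.comap (leftReg G g)
    refine Submodule.span_le.2 ?_
    rintro _ ⟨a, h, rfl⟩
    exact Submodule.subset_span ⟨g * a, h, by simp⟩
  have hUU : ∀ g, ∀ x ∈ Uᗮᗮ, leftReg G g x ∈ Uᗮᗮ := fun g x hx =>
    leftReg_mem_orthogonal (fun g x hx => leftReg_mem_orthogonal hU g hx) g hx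
  let p : GroupVN G := invariantProjection Uᗮᗮ hUU
  have hpp : p * p = p := Subtype.ext Uᗮᗮ.isIdempotentElem_starProjection
  -- An equivariant bounded operator killing the values of `c` kills the closed span of their
  -- translates, which is the range of `p`.
  have hker : ∀ R : GroupVN G, R • c = 0 → R * p = 0 := by
    intro R hR
    have h1 : Uᗮᗮ ≤ LinearMap.ker R.op.toLinearMap := by
      rw [Submodule.orthogonal_orthogonal_eq_closure]
      refine Submodule.topologicalClosure_minimal _ (Submodule.span_le.2 ?_) R.op.isClosed_ker
      rintro _ ⟨g, h, rfl⟩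
      have h2 : R.op (c h) = 0 := congrFun hR h
      change R.op (leftReg G g (c h)) = 0
      have h3 : R.op (leftReg G g (c h)) = leftReg G g (R.op (c h)) := R.2 g (c h)
      rw [h3, h2, map_zero]
    refine Subtype.ext (ContinuousLinearMap.ext fun x => ?_)
    exact h1 (Uᗮᗮ.starProjection_apply_mem x)
  -- The trace is `‖p δ₁‖²`. If it vanished, `δ₁` would be orthogonal to every translate of every `c
  -- h`, that is, all coefficients of `c` would vanish.
  have htrace : 0 < (vnTrace p).re := by
    rw [vnTrace_invariantProjection]
    refine pow_pos (norm_pos_iff.2 fun h0 => hc' ?_) 2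
    have h1 : (lp.single 2 (1 : G) (1 : ℂ) : EllTwo G) ∈ Uᗮ := by
      have h2 := Uᗮᗮ.sub_starProjection_mem_orthogonal (lp.single 2 (1 : G) (1 : ℂ) : EllTwo G)
      rw [h0, sub_zero] at h2
      rwa [Submodule.triorthogonal_eq_orthogonal] at h2
    refine mem_coboundariesVN.2 ⟨0, fun h => ?_⟩
    rw [map_zero, sub_zero]
    ext g
    have h3 := h1 _ (Submodule.subset_span ⟨g⁻¹, h, rfl⟩)
    rw [lp.inner_single_right] at h3
    simpa [leftReg_apply] using h3
  let q : ReducedH1 G := Submodule.Quotient.mk ⟨c, hc⟩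
  have hq : ∀ R : GroupVN G, R • q = 0 → R * p = 0 := by
    intro R hR
    refine hker R (smul_eq_zero_of_mem_coboundariesVN hε hF horth R ?_)
    rw [← Submodule.Quotient.mk_smul, Submodule.Quotient.mk_eq_zero, Submodule.submoduleOf,
      Submodule.mem_comap,
      topologicalClosure_coboundariesVN hG] at hR
    exact hR
  let e : Matrix (Fin 1) (Fin 1) (GroupVN G) := Matrix.of fun _ _ => p
  have hee : e * e = e := by
    ext i j
    simp [e, Matrix.mul_apply, hpp]
  -- This is `x p ↦ x p • q` on `N(G)p`. If `x p • q = 0`, then `x p = x p p = 0` by `hq`.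
  let f : LinearMap.range e.vecMulLinear →ₗ[GroupVN G] ReducedH1 G :=
    (LinearMap.toSpanSingleton (GroupVN G) (ReducedH1 G) q).comp
      ((LinearMap.proj 0).comp (Submodule.subtype _))
  have hf : Function.Injective f := by
    rw [injective_iff_map_eq_zero]
    rintro ⟨_, v, rfl⟩ hv
    have h1 : e.vecMulLinear v 0 = v 0 * p := by
      simp [e, Matrix.vecMul, dotProduct]
    have h2 : e.vecMulLinear v 0 * p = 0 := hq _ hv
    rw [h1, mul_assoc, hpp, ← h1] at h2
    refine Subtype.ext (funext fun i => ?_)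
    rw [Subsingleton.elim i 0]
    exact h2
  refine lt_of_lt_of_le ?_ (le_iSup_of_le 1 (le_iSup_of_le e (le_iSup_of_le ⟨hee, f, hf⟩ le_rfl)))
  simpa [e] using htrace

theorem bettiOne_eq_zero {G : Type} [Group G]
    (hH : Subsingleton (groupCohomology.H1 (ellTwoRep G))) : bettiOne G = 0 := by
  have hsub : Subsingleton (ReducedH1 G) := by
    rw [Submodule.Quotient.subsingleton_iff, eq_top_iff]
    rintro ⟨c, hc⟩ -
    refine Submodule.le_topologicalClosure _ (mem_coboundariesVN.2 ?_)
    exact (groupCohomology.subsingleton_H1_iff _).1 hH c (mem_cocyclesVN.1 hc)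
  unfold bettiOne vnDim
  refine le_antisymm (iSup_le fun n => iSup_le fun e => iSup_le ?_) zero_le
  rintro ⟨-, f, hf⟩
  have : Subsingleton (LinearMap.range e.vecMulLinear) := hf.subsingleton
  -- The rows of `e` lie in its range, so a trivial range forces `e = 0`.
  have he : ∀ i j, e i j = 0 := by
    intro i j
    have h1 : (⟨e.vecMulLinear (Pi.single i 1), ⟨_, rfl⟩⟩ : LinearMap.range e.vecMulLinear) = 0 :=
      Subsingleton.elim _ _
    have h2 := congrFun (congrArg Subtype.val h1) j
    simpa using h2
  have h0 : vnTrace (0 : GroupVN G) = 0 := rfl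
  simp [he, h0]

end

theorem mainTheorem8 {V A : Type} [Nonempty A] (X : GraphOfGroups V A) (T : Set A)
    (hT : X.IsMaximalTree T)
    (hV : ∀ v : V, Subsingleton (groupCohomology.H1 (ellTwoRes (X.ofVertex T v)))) :
    ((∀ e : A, Infinite (X.edgeGroup e)) →
      Subsingleton (groupCohomology.H1 (ellTwoRep (X.PiOne T))) ∧ bettiOne (X.PiOne T) = 0) ∧
    ((∃ e : A, Finite (X.edgeGroup e) ∧ X.tgt e = X.src e) →
      Nontrivial (groupCohomology.H1 (ellTwoRep (X.PiOne T))) ∧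
        (¬ AmenableGroup (X.PiOne T) → 0 < bettiOne (X.PiOne T))) ∧
    ((∃ e : A, Finite (X.edgeGroup e) ∧ X.tgt e ≠ X.src e ∧
        2 ≤ ENat.card (X.vertexGroup (X.tgt e) ⧸ (X.toTgt e).range) ∧
        2 ≤ ENat.card (X.vertexGroup (X.src e) ⧸ (X.toSrc e).range)) →
      Nontrivial (groupCohomology.H1 (ellTwoRep (X.PiOne T))) ∧
        (¬ AmenableGroup (X.PiOne T) → 0 < bettiOne (X.PiOne T))) := by
  refine ⟨fun hE => ?_, ?_, ?_⟩
  · have h := hT.subsingleton_H1 hV hE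
    exact ⟨h, bettiOne_eq_zero h⟩
  · rintro ⟨e, _, he⟩
    -- A loop never belongs to a maximal tree.
    have h := GraphOfGroups.nontrivial_H1_of_notMem (X := X) (T := T) (e := e) fun heT => hT.1 e heT he.symm
    exact ⟨h, fun hG => bettiOne_pos hG h⟩
  · rintro ⟨e, _, -, ht, hs⟩
    have h : Nontrivial (groupCohomology.H1 (ellTwoRep (X.PiOne T))) := by
      by_cases heT : e ∈ T
      · obtain ⟨b, hb⟩ := Subgroup.exists_notMem_of_two_le ht
        obtain ⟨a, ha⟩ := Subgroup.exists_notMem_of_two_le hs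
        exact hT.nontrivial_H1_of_mem heT ha hb
      · exact GraphOfGroups.nontrivial_H1_of_notMem heT
    exact ⟨h, fun hG => bettiOne_pos hG h⟩
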